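/- **Proposition (self-adjointness).** Let $N\ge 2$ and consider a star graph consisting of $N$ links of lengths $\ell_j\in(0,\infty]$, $j=1,\dots,N$, joined at a single vertex, the $j$-th link being identified with the interval $(0,\ell_j)$ and the vertex with its endpoint $0$. Let $\mathcal H:=\bigoplus_{j=1}^N L^2(0,\ell_j)$ (complex-valued functions), and let $V=\{V_j\}_{j=1}^N$ be real-valued potentials on the links such that * (p1) $V_j$ is locally integrable on its link up to the finite endpoints, i.e. $V_j$ is integrable over every bounded subinterval of $(0,\ell_j)$, $j=1,\dots,N$; * (p2) if $\ell_j=\infty$, the differential expression $-\frac{d^2}{dx^2}+V_j(x)$ is in the limit point case at infinity, i.e. there is no $z\in\mathbb C$ for which all solutions of $-u''+V_ju=zu$ on $(0,\infty)$ are square integrable near infinity; if $\ell_j<\infty$, a number $\omega_j\in\mathbb R$ is fixed. For $\alpha\in\mathbb R\cup\{\infty\}$ let $H_\alpha(V)$ be the operator in $\mathcal H$ acting as $$H_\alpha(V)\{\psi_j\}:=\{-\psi_j''+V_j\psi_j\},$$ whose domain consists of all $\{\psi_j\}\in\mathcal H$ such that, for every $j$, $\psi_j$ and $\psi_j'$ are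 locally absolutely continuous on $(0,\ell_j)$ and $-\psi_j''+V_j\psi_j\in L^2(0,\ell_j)$; at the end of every link with $\ell_j<\infty$ one has $$\psi_j(\ell_j)\cos\omega_j+\psi_j'(\ell_j)\sin\omega_j=0;$$ and at the vertex, if $\alpha\in\mathbb R$, $$\psi_1(0+)=\cdots=\psi_N(0+)=:\psi,\qquad \sum_{j=1}^N\psi_j'(0+)=\alpha\,\psi,$$ while if $\alpha=\infty$, $\psi_j(0+)=0$ for $j=1,\dots,N$. (Values at endpoints are one-sided limits, whose existence is part of the condition.) Then $H_\alpha(V)$ is self-adjoint for every $\alpha\in\mathbb R\cup\{\infty\}$. -/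

import Mathlib

open MeasureTheory Filter Topology Set

noncomputable section

namespace StarGraph

/-- The open link `(0, ℓ)`, where the length `ℓ` is a positive real number or `∞`. -/
def link (ℓ : EReal) : Set ℝ := {x : ℝ | 0 < x ∧ (x : EReal) < ℓ}

/-- The link together with its finite endpoints: `[0, ℓ]` if `ℓ < ∞` and `[0, ∞)` if `ℓ = ∞`. -/
def closedLink (ℓ : EReal) : Set ℝ := {x : ℝ | 0 ≤ x ∧ (x : EReal) ≤ ℓ}

lemma isOpen_link (ℓ : EReal) : IsOpen (link ℓ) :=
  (isOpen_lt continuous_const continuous_id).inter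
    (isOpen_lt continuous_coe_real_ereal continuous_const)

/-- On the open set `I`, the function `u` is continuously differentiable with derivative `w`, the
function `w = u'` is locally absolutely continuous, and `-u'' + V u = f` almost everywhere. -/
structure SolvesOn (I : Set ℝ) (V : ℝ → ℝ) (u w f : ℝ → ℂ) : Prop where
  hasDerivAt : ∀ x ∈ I, HasDerivAt u (w x) x
  absolutelyContinuous : ∀ a ∈ I, ∀ b ∈ I, AbsolutelyContinuousOnInterval w a b
  ae_eq : ∀ᵐ x ∂(volume.restrict I), HasDerivAt w ((V x : ℂ) * u x - f x) x

/-- The expression `-d²/dx² + V` is in the limit circle case at infinity: for some `z ∈ ℂ`, all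
solutions of `-u'' + V u = z u` are square integrable near infinity. -/
def IsLimitCircleAtInfinity (V : ℝ → ℝ) : Prop :=
  ∃ z : ℂ, ∀ u w : ℝ → ℂ, SolvesOn (Ioi 0) V u w (fun x => z * u x) →
    ∃ c > (0 : ℝ), MemLp u 2 (volume.restrict (Ioi c))

/-- The limit point case at infinity. -/
def IsLimitPointAtInfinity (V : ℝ → ℝ) : Prop := ¬ IsLimitCircleAtInfinity V

/-- The state space `⨁ j, L²(0, ℓ j)`. -/
abbrev StateSpace {N : ℕ} (ℓ : Fin N → EReal) : Type :=
  PiLp 2 (fun j : Fin N => Lp ℂ 2 (volume.restrict (link (ℓ j))))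

/-- The condition at the vertex, `u j` being the wave function on the `j`th link and `w j` its
derivative: for `α ∈ ℝ`, the boundary values `u j (0+)` exist and have a common value `c`, the
boundary values `w j (0+)` exist, and they sum up to `α c`; for `α = ∞`, the Dirichlet condition. -/
def VertexCondition {N : ℕ} (α : OnePoint ℝ) (u w : Fin N → ℝ → ℂ) : Prop :=
  (∀ a : ℝ, α = (a : OnePoint ℝ) → ∃ (c : ℂ) (d : Fin N → ℂ),
      (∀ j, Tendsto (u j) (𝓝[>] 0) (𝓝 c)) ∧ (∀ j, Tendsto (w j) (𝓝[>] 0) (𝓝 (d j))) ∧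
      ∑ j, d j = (a : ℂ) * c) ∧
  (α = OnePoint.infty → ∀ j, Tendsto (u j) (𝓝[>] 0) (𝓝 0))

/-- The condition `u(L) cos ω + u'(L) sin ω = 0` at the end of each link of finite length `L`. -/
def EndCondition {N : ℕ} (ℓ : Fin N → EReal) (ω : Fin N → ℝ) (u w : Fin N → ℝ → ℂ) : Prop :=
  ∀ (j : Fin N) (L : ℝ), ℓ j = (L : EReal) → ∃ c d : ℂ,
    Tendsto (u j) (𝓝[<] L) (𝓝 c) ∧ Tendsto (w j) (𝓝[<] L) (𝓝 d) ∧
    c * (Real.cos (ω j) : ℂ) + d * (Real.sin (ω j) : ℂ) = 0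

lemma SolvesOn.zero (I : Set ℝ) (V : ℝ → ℝ) : SolvesOn I V 0 0 0 where
  hasDerivAt x _ := hasDerivAt_const x 0
  absolutelyContinuous a _ b _ := by
    simp [AbsolutelyContinuousOnInterval, tendsto_const_nhds]
  ae_eq := by
    filter_upwards with x
    simp

lemma SolvesOn.add {I : Set ℝ} {V : ℝ → ℝ} {u w f u' w' f' : ℝ → ℂ}
    (h : SolvesOn I V u w f) (h' : SolvesOn I V u' w' f') :
    SolvesOn I V (u + u') (w + w') (f + f') where
  hasDerivAt x hx := (h.hasDerivAt x hx).add (h'.hasDerivAt x hx)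
  absolutelyContinuous a ha b hb :=
    (h.absolutelyContinuous a ha b hb).add (h'.absolutelyContinuous a ha b hb)
  ae_eq := by
    filter_upwards [h.ae_eq, h'.ae_eq] with x h1 h2
    have := h1.add h2
    rw [show ((V x : ℂ) * u x - f x) + ((V x : ℂ) * u' x - f' x) =
      (V x : ℂ) * (u + u') x - (f + f') x by simp only [Pi.add_apply]; ring] at this
    exact this

lemma SolvesOn.smul {I : Set ℝ} {V : ℝ → ℝ} {u w f : ℝ → ℂ} (k : ℂ) (h : SolvesOn I V u w f) :
    SolvesOn I V (k • u) (k • w) (k • f) where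
  hasDerivAt x hx := (h.hasDerivAt x hx).const_smul k
  absolutelyContinuous a ha b hb := (h.absolutelyContinuous a ha b hb).const_smul k
  ae_eq := by
    filter_upwards [h.ae_eq] with x h1
    have := h1.const_smul k
    rw [show k • ((V x : ℂ) * u x - f x) = (V x : ℂ) * (k • u) x - (k • f) x by
      simp only [Pi.smul_apply, smul_eq_mul]; ring] at this
    exact this

lemma SolvesOn.congr {I : Set ℝ} {V : ℝ → ℝ} {u w f f' : ℝ → ℂ} (h : SolvesOn I V u w f)
    (hf : f' =ᵐ[volume.restrict I] f) : SolvesOn I V u w f' where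
  hasDerivAt := h.hasDerivAt
  absolutelyContinuous := h.absolutelyContinuous
  ae_eq := by
    filter_upwards [h.ae_eq, hf] with x h1 h2
    rwa [h2]

/-- The graph of `H_α(V)`: all pairs `(ψ, f)` of states such that `ψ` has, on every link, a
representative `u j` which is differentiable with a locally absolutely continuous derivative and
satisfies `-(u j)'' + V j (u j) = f j`, and such that the boundary conditions hold. -/
def hamiltonianGraph {N : ℕ} (ℓ : Fin N → EReal) (V : Fin N → ℝ → ℝ) (ω : Fin N → ℝ)
    (α : OnePoint ℝ) : Submodule ℂ (StateSpace ℓ × StateSpace ℓ) where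
  carrier := {p | ∃ u w : Fin N → ℝ → ℂ,
    (∀ j, (p.1 j : ℝ → ℂ) =ᵐ[volume.restrict (link (ℓ j))] u j) ∧
    (∀ j, SolvesOn (link (ℓ j)) (V j) (u j) (w j) (p.2 j)) ∧
    VertexCondition α u w ∧ EndCondition ℓ ω u w}
  zero_mem' := by
    refine ⟨0, 0, fun j => Lp.coeFn_zero _ _ _,
      fun j => (SolvesOn.zero _ _).congr (Lp.coeFn_zero _ _ _), ⟨fun a _ => ?_, fun _ j => ?_⟩,
      fun j L _ => ?_⟩
    · exact ⟨0, 0, fun j => tendsto_const_nhds, fun j => tendsto_const_nhds, by simp⟩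
    · exact tendsto_const_nhds
    · exact ⟨0, 0, tendsto_const_nhds, tendsto_const_nhds, by simp⟩
  add_mem' := by
    rintro p q ⟨u, w, h1, h2, h3, h4⟩ ⟨u', w', h1', h2', h3', h4'⟩
    refine ⟨u + u', w + w', fun j => (Lp.coeFn_add _ _).trans ((h1 j).add (h1' j)),
      fun j => ((h2 j).add (h2' j)).congr (Lp.coeFn_add _ _), ⟨fun a ha => ?_, fun ha j => ?_⟩,
      fun j L hL => ?_⟩
    · obtain ⟨c, d, hc, hd, he⟩ := h3.1 a ha
      obtain ⟨c', d', hc', hd', he'⟩ := h3'.1 a ha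
      refine ⟨c + c', d + d', fun j => (hc j).add (hc' j), fun j => (hd j).add (hd' j), ?_⟩
      simp only [Pi.add_apply, Finset.sum_add_distrib, he, he']
      ring
    · have := (h3.2 ha j).add (h3'.2 ha j)
      rw [add_zero] at this
      exact this
    · obtain ⟨c, d, hc, hd, he⟩ := h4 j L hL
      obtain ⟨c', d', hc', hd', he'⟩ := h4' j L hL
      exact ⟨c + c', d + d', hc.add hc', hd.add hd', by linear_combination he + he'⟩
  smul_mem' := by
    rintro k p ⟨u, w, h1, h2, h3, h4⟩
    refine ⟨k • u, k • w, fun j => (Lp.coeFn_smul _ _).trans ((h1 j).const_smul k),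
      fun j => ((h2 j).smul k).congr (Lp.coeFn_smul _ _), ⟨fun a ha => ?_, fun ha j => ?_⟩,
      fun j L hL => ?_⟩
    · obtain ⟨c, d, hc, hd, he⟩ := h3.1 a ha
      refine ⟨k • c, k • d, fun j => (hc j).const_smul k, fun j => (hd j).const_smul k, ?_⟩
      simp only [Pi.smul_apply, smul_eq_mul, ← Finset.mul_sum, he]
      ring
    · have := (h3.2 ha j).const_smul k
      rw [smul_zero] at this
      exact this
    · obtain ⟨c, d, hc, hd, he⟩ := h4 j L hL
      refine ⟨k • c, k • d, hc.const_smul k, hd.const_smul k, ?_⟩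
      simp only [smul_eq_mul]
      linear_combination k * he

/-- `hamiltonianGraph` is single valued, hence really the graph of an operator. -/
lemma hamiltonianGraph_snd_eq_zero {N : ℕ} (ℓ : Fin N → EReal) (V : Fin N → ℝ → ℝ)
    (ω : Fin N → ℝ) (α : OnePoint ℝ) (p : StateSpace ℓ × StateSpace ℓ)
    (hp : p ∈ hamiltonianGraph ℓ V ω α) (h0 : p.1 = 0) : p.2 = 0 := by
  obtain ⟨u, w, h1, h2, -, -⟩ := hp
  ext1 j
  have hI := isOpen_link (ℓ j)
  have hu : EqOn (u j) 0 (link (ℓ j)) := by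
    refine Measure.eqOn_open_of_ae_eq (μ := volume) ?_ hI
      (fun x hx => ((h2 j).hasDerivAt x hx).continuousAt.continuousWithinAt) continuousOn_const
    refine (h1 j).symm.trans ?_
    rw [h0]
    exact Lp.coeFn_zero _ _ _
  have hw : EqOn (w j) 0 (link (ℓ j)) := fun x hx =>
    ((h2 j).hasDerivAt x hx).unique ((hasDerivAt_const x (0 : ℂ)).congr_of_eventuallyEq
      (by filter_upwards [hI.mem_nhds hx] with y hy using hu hy))
  refine Lp.ext (EventuallyEq.trans ?_ (Lp.coeFn_zero _ _ _).symm)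
  filter_upwards [(h2 j).ae_eq, ae_restrict_mem hI.measurableSet] with x hx hxI
  have := hx.unique ((hasDerivAt_const x (0 : ℂ)).congr_of_eventuallyEq
      (by filter_upwards [hI.mem_nhds hxI] with y hy using hw hy))
  rw [hu hxI] at this
  simpa using this

/-- The operator `H_α(V)`, with the fixed boundary conditions given by `ω` at the finite ends. -/
def hamiltonian {N : ℕ} (ℓ : Fin N → EReal) (V : Fin N → ℝ → ℝ) (ω : Fin N → ℝ)
    (α : OnePoint ℝ) : StateSpace ℓ →ₗ.[ℂ] StateSpace ℓ :=
  (hamiltonianGraph ℓ V ω α).toLinearPMap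

lemma hamiltonian_graph {N : ℕ} (ℓ : Fin N → EReal) (V : Fin N → ℝ → ℝ) (ω : Fin N → ℝ)
    (α : OnePoint ℝ) : (hamiltonian ℓ V ω α).graph = hamiltonianGraph ℓ V ω α :=
  Submodule.toLinearPMap_graph_eq _ (hamiltonianGraph_snd_eq_zero ℓ V ω α)

end StarGraph

end

noncomputable section

namespace StarGraph

/-! ### Absolutely continuous functions with values in a normed space -/

section Calculus

variable {E : Type*} [NormedAddCommGroup E] [NormedSpace ℝ E]

/-! The proof rests on `isSelfAdjoint_of_surjective`: a symmetric operator for which `A - z` is onto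
for all nonreal `z` is self-adjoint, and density of the domain comes for free. Potentials are
extended by zero to the whole line, which is harmless because they are integrable up to the finite
endpoints. Solutions then become global C¹ functions, and the one-sided limits in the boundary
conditions become point values (`SolvesOn.exists_isSol`).

Symmetry is Green's identity on each link. The boundary term vanishes at a finite end because the
condition there is real, and at infinity by the limit point property
(`tendsto_wronskian_of_limitPoint`). What remains at the vertex sums to zero because `α` is real or
infinite (`sum_vertex_eq_zero`).

For surjectivity, take on each link the Dirichlet solution `r j` of the inhomogeneous equation and
add a common multiple `k` of the Weyl solution `ψ j`, normalised by `ψ j 0 = 1`. For real `α` the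
vertex condition becomes one linear equation for `k`, with coefficient `α - ∑ j, ψ' j 0`. This is
nonzero because every `Im (ψ' j 0)` has the sign of `Im z`.

On a half-line both solutions are ultrafilter limits of regular problems on `[0, n + 1]` with a
Dirichlet condition at `n + 1`; the energy identity `IsSolAt.integral_energy` gives bounds uniform
in `n`. Solutions obtained this way (`IsApproximable`) are square integrable, and their mutual
Wronskians vanish at infinity, since the Wronskians of the approximants vanish at `n + 1`. The limit
point hypothesis enters only through `isApproximable_of_memLp`, which makes every square integrable
solution with square integrable source approximable, and so serves symmetry alone. -/

lemma intervalIntegrable_of_locallyIntegrable {E : Type*} [NormedAddCommGroup E] {f : ℝ → E}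
    (hf : LocallyIntegrable f) (a b : ℝ) : IntervalIntegrable f volume a b :=
  intervalIntegrable_iff.mpr
    ((hf.integrableOn_isCompact isCompact_uIcc).mono_set uIoc_subset_uIcc)

lemma locallyIntegrable_of_intervalIntegrable {E : Type*} [NormedAddCommGroup E] {f : ℝ → E}
    (hf : ∀ a b, IntervalIntegrable f volume a b) : LocallyIntegrable f := by
  intro x
  have h := (intervalIntegrable_iff_integrableOn_Ioc_of_le
    (show x - 1 ≤ x + 1 by linarith)).1 (hf (x - 1) (x + 1))
  exact ⟨_, Ioc_mem_nhds (by linarith) (by linarith), h⟩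

/-- The primitive of an integrable function is absolutely continuous. -/
lemma absolutelyContinuous_primitive {f : ℝ → E} {a b c : ℝ}
    (h : IntervalIntegrable f volume a b) (hc : c ∈ uIcc a b) :
    AbsolutelyContinuousOnInterval (fun x => ∫ t in c..x, f t) a b := by
  have h1 := h.norm.absolutelyContinuousOnInterval_intervalIntegral hc
  rw [absolutelyContinuousOnInterval_iff] at h1 ⊢
  intro ε hε
  obtain ⟨δ, hδ, h2⟩ := h1 ε hε
  refine ⟨δ, hδ, fun I hI hlt => lt_of_le_of_lt (Finset.sum_le_sum fun i hi => ?_) (h2 I hI hlt)⟩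
  obtain ⟨hx, hy⟩ := hI.1 i hi
  have hcx : uIcc c (I.2 i).1 ⊆ uIcc a b := uIcc_subset_uIcc hc hx
  have hcy : uIcc c (I.2 i).2 ⊆ uIcc a b := uIcc_subset_uIcc hc hy
  rw [dist_eq_norm, dist_eq_norm,
    intervalIntegral.integral_interval_sub_left (h.mono_set hcx) (h.mono_set hcy),
    intervalIntegral.integral_interval_sub_left (h.norm.mono_set hcx) (h.norm.mono_set hcy)]
  exact intervalIntegral.norm_integral_le_abs_integral_norm

/-- The fundamental theorem of calculus for absolutely continuous functions. -/
lemma integral_eq_sub_of_absolutelyContinuous [CompleteSpace E] {w g : ℝ → E} {a b : ℝ}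
    (hw : AbsolutelyContinuousOnInterval w a b) (hg : IntervalIntegrable g volume a b)
    (hd : ∀ᵐ x, x ∈ uIcc a b → HasDerivAt w (g x) x) :
    ∫ t in a..b, g t = w b - w a := by
  -- The difference between `w` and the primitive of `g` is absolutely continuous with zero
  -- derivative almost everywhere, hence constant.
  have h1 := hw.sub (absolutelyContinuous_primitive hg left_mem_uIcc)
  have h2 : ∀ᵐ x, x ∈ uIcc a b → HasDerivAt (w - fun x => ∫ t in a..x, g t) 0 x := by
    filter_upwards [hd, hg.ae_hasDerivAt_integral] with x hx1 hx2 hx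
    simpa using (hx1 hx).sub (hx2 hx a left_mem_uIcc)
  obtain ⟨C, hC⟩ := h1.const_of_ae_hasDerivAt_zero h2
  have ha := hC a left_mem_uIcc
  have hb := hC b right_mem_uIcc
  simp only [Pi.sub_apply, intervalIntegral.integral_same, sub_zero] at ha hb
  rw [ha, ← hb]
  abel

lemma absolutelyContinuous_comp {X Y : Type*} [PseudoMetricSpace X] [PseudoMetricSpace Y]
    {f : ℝ → X} {g : X → Y} {a b : ℝ} {K : NNReal}
    (hf : AbsolutelyContinuousOnInterval f a b) (hg : LipschitzOnWith K g (f '' uIcc a b)) :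
    AbsolutelyContinuousOnInterval (fun x => g (f x)) a b := by
  rw [absolutelyContinuousOnInterval_iff] at hf ⊢
  intro ε hε
  -- The `+ 1` covers `K = 0`.
  obtain ⟨δ, hδ, h2⟩ := hf (ε / (K + 1)) (by positivity)
  refine ⟨δ, hδ, fun I hI hlt => ?_⟩
  have h3 := h2 I hI hlt
  calc _ ≤ ∑ i ∈ Finset.range I.1, (K + 1 : ℝ) * dist (f (I.2 i).1) (f (I.2 i).2) := by
        refine Finset.sum_le_sum fun i hi => ?_
        obtain ⟨hx, hy⟩ := hI.1 i hi
        refine (hg.dist_le_mul _ (mem_image_of_mem f hx) _ (mem_image_of_mem f hy)).trans ?_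
        gcongr
        linarith
    _ < ε := by
        rw [← Finset.mul_sum, mul_comm]
        exact (lt_div_iff₀ (by positivity)).1 h3

lemma absolutelyContinuous_exp {f : ℝ → ℝ} {a b : ℝ}
    (hf : AbsolutelyContinuousOnInterval f a b) :
    AbsolutelyContinuousOnInterval (fun x => Real.exp (f x)) a b := by
  obtain ⟨C, hC⟩ := hf.exists_bound
  refine absolutelyContinuous_comp (K := (Real.exp C).toNNReal) hf
    (LipschitzOnWith.mono (t := Iic C) ?_ ?_)
  · refine Convex.lipschitzOnWith_of_nnnorm_deriv_le (𝕜 := ℝ)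
      (fun x _ => Real.differentiableAt_exp) (fun x hx => ?_) (convex_Iic C)
    rw [Real.deriv_exp, ← NNReal.coe_le_coe, coe_nnnorm, Real.norm_eq_abs, Real.abs_exp,
      Real.coe_toNNReal _ (Real.exp_pos _).le]
    exact Real.exp_le_exp.2 hx
  · rintro _ ⟨x, hx, rfl⟩
    exact (le_abs_self _).trans (hC x hx)

/-- The integrand is the almost everywhere derivative of an absolutely continuous exponential. No
sign is imposed on `k`: negative values serve integration to the left of `a`. -/
lemma integral_mul_exp_primitive {ρ : ℝ → ℝ} (hρ : LocallyIntegrable ρ) (a b k : ℝ) :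
    ∫ t in a..b, k * ρ t * Real.exp (k * ∫ s in a..t, ρ s) =
      Real.exp (k * ∫ s in a..b, ρ s) - 1 := by
  have hi := intervalIntegrable_of_locallyIntegrable hρ
  have hc : Continuous fun x => ∫ s in a..x, ρ s := intervalIntegral.continuous_primitive hi a
  have h1 : AbsolutelyContinuousOnInterval (fun x => k * ∫ s in a..x, ρ s) a b :=
    (absolutelyContinuous_primitive (hi a b) left_mem_uIcc).const_mul k
  rw [integral_eq_sub_of_absolutelyContinuous (absolutelyContinuous_exp h1)]
  · simp
  · exact ((hi a b).const_mul k).mul_continuousOn (by fun_prop)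
  · filter_upwards [LocallyIntegrable.ae_hasDerivAt_integral hρ] with x hx _
    exact ((hx a).const_mul k).exp.congr_deriv (by ring)

/-- Integral form of Gronwall's estimate, with an exponential weight. -/
lemma norm_integral_le_exp {ρ : ℝ → ℝ} (hρ : LocallyIntegrable ρ) (hρ0 : ∀ t, 0 ≤ ρ t)
    {a x k M : ℝ} (hk : 0 < k) (hM : 0 ≤ M) {g : ℝ → E}
    (hg : ∀ t ∈ uIcc a x, ‖g t‖ ≤ M * ρ t * Real.exp (k * |∫ s in a..t, ρ s|)) :
    ‖∫ t in a..x, g t‖ ≤ M / k * Real.exp (k * |∫ s in a..x, ρ s|) := by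
  have hi := intervalIntegrable_of_locallyIntegrable hρ
  have hc : Continuous fun x => ∫ s in a..x, ρ s := intervalIntegral.continuous_primitive hi a
  have h1 : ‖∫ t in a..x, g t‖ ≤
      |∫ t in a..x, M * ρ t * Real.exp (k * |∫ s in a..t, ρ s|)| := by
    refine intervalIntegral.norm_integral_le_abs_of_norm_le ?_ ?_
    · filter_upwards [ae_restrict_mem measurableSet_uIoc] with t ht
      exact hg t (uIoc_subset_uIcc ht)
    · exact ((hi a x).const_mul M).mul_continuousOn (by fun_prop)
  refine h1.trans ?_
  rcases le_total a x with hax | hax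
  · have h2 : ∫ t in a..x, M * ρ t * Real.exp (k * |∫ s in a..t, ρ s|) =
        M / k * ∫ t in a..x, k * ρ t * Real.exp (k * ∫ s in a..t, ρ s) := by
      rw [← intervalIntegral.integral_const_mul]
      refine intervalIntegral.integral_congr fun t ht => ?_
      rw [uIcc_of_le hax] at ht
      have : 0 ≤ ∫ s in a..t, ρ s := intervalIntegral.integral_nonneg ht.1 fun s _ => hρ0 s
      simp only [abs_of_nonneg this]
      field_simp
    have h3 : 0 ≤ ∫ s in a..x, ρ s := intervalIntegral.integral_nonneg hax fun s _ => hρ0 s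
    rw [h2, integral_mul_exp_primitive hρ, abs_of_nonneg h3, abs_of_nonneg]
    · gcongr
      linarith
    · have := Real.one_le_exp (mul_nonneg hk.le h3)
      have : 0 ≤ Real.exp (k * ∫ s in a..x, ρ s) - 1 := by linarith
      positivity
  · have hneg : ∀ t ≤ a, ∫ s in a..t, ρ s ≤ 0 := fun t ht => by
      rw [intervalIntegral.integral_symm]
      have := intervalIntegral.integral_nonneg (μ := volume) ht fun s _ => hρ0 s
      linarith
    have h2 : ∫ t in a..x, M * ρ t * Real.exp (k * |∫ s in a..t, ρ s|) =
        -(M / k) * ∫ t in a..x, (-k) * ρ t * Real.exp ((-k) * ∫ s in a..t, ρ s) := by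
      rw [← intervalIntegral.integral_const_mul]
      refine intervalIntegral.integral_congr fun t ht => ?_
      rw [uIcc_of_ge hax] at ht
      simp only [abs_of_nonpos (hneg t ht.2), mul_neg, neg_mul, neg_neg]
      field_simp
    have h3 := hneg x hax
    rw [h2, integral_mul_exp_primitive hρ, abs_of_nonpos h3, neg_mul, abs_neg, abs_of_nonneg]
    · rw [mul_neg, neg_mul]
      gcongr
      linarith
    · have := Real.one_le_exp (show 0 ≤ -k * ∫ s in a..x, ρ s by nlinarith)
      have : 0 ≤ Real.exp (-k * ∫ s in a..x, ρ s) - 1 := by linarith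
      positivity

end Calculus

/-! ### Carathéodory differential equations -/

section Caratheodory

variable {E : Type*} [NormedAddCommGroup E] [NormedSpace ℝ E]

/-- Global solvability of the initial value problem for a vector field which is Lipschitz in space
with a locally integrable constant. -/
theorem exists_caratheodory [CompleteSpace E] {G : ℝ → E → E} {ρ : ℝ → ℝ} (hρ : LocallyIntegrable ρ)
    (hρ0 : ∀ t, 0 ≤ ρ t) (hLip : ∀ t x y, ‖G t x - G t y‖ ≤ ρ t * ‖x - y‖)
    (hG0 : ∀ t, ‖G t 0‖ ≤ ρ t)
    (hG : ∀ Y : ℝ → E, Continuous Y → LocallyIntegrable fun t => G t (Y t)) (a : ℝ) (y : E) :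
    ∃ Y : ℝ → E, Continuous Y ∧ ∀ x, Y x = y + ∫ t in a..x, G t (Y t) := by
  have hi := intervalIntegrable_of_locallyIntegrable hρ
  have hc : Continuous fun x => ∫ s in a..x, ρ s := intervalIntegral.continuous_primitive hi a
  -- Bielecki's weight: the fixed point problem is posed for the bounded function `v = exp (-lam) •
  -- Y`. The factor 2 turns the Lipschitz bound into the contraction constant 1/2 on the whole line
  -- at once.
  set lam : ℝ → ℝ := fun x => 2 * |∫ s in a..x, ρ s| with hlam
  have hlamc : Continuous lam := by fun_prop
  have hlam0 : ∀ x, 0 ≤ lam x := fun x => by positivity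
  have hYc : ∀ v : BoundedContinuousFunction ℝ E,
      Continuous fun t => Real.exp (lam t) • v t := fun v => by fun_prop
  have hcont : ∀ v : BoundedContinuousFunction ℝ E, Continuous fun x =>
      Real.exp (-lam x) • (y + ∫ t in a..x, G t (Real.exp (lam t) • v t)) := by
    intro v
    have := intervalIntegral.continuous_primitive
      (intervalIntegrable_of_locallyIntegrable (hG _ (hYc v))) a
    fun_prop
  have hbd : ∀ (v : BoundedContinuousFunction ℝ E) (x : ℝ),
      ‖Real.exp (-lam x) • (y + ∫ t in a..x, G t (Real.exp (lam t) • v t))‖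
        ≤ ‖y‖ + (‖v‖ + 1) / 2 := by
    intro v x
    have h1 : ‖∫ t in a..x, G t (Real.exp (lam t) • v t)‖ ≤
        (‖v‖ + 1) / 2 * Real.exp (lam x) := by
      refine norm_integral_le_exp hρ hρ0 two_pos (by positivity) fun t _ => ?_
      have e1 : ‖G t (Real.exp (lam t) • v t)‖ ≤
          ρ t * (Real.exp (lam t) * ‖v‖) + ρ t := by
        calc _ = ‖(G t (Real.exp (lam t) • v t) - G t 0) + G t 0‖ := by rw [sub_add_cancel]
          _ ≤ _ := norm_add_le _ _
          _ ≤ ρ t * ‖Real.exp (lam t) • v t - 0‖ + ρ t := add_le_add (hLip _ _ _) (hG0 t)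
          _ ≤ _ := by
            rw [sub_zero, norm_smul, Real.norm_eq_abs, Real.abs_exp]
            have := hρ0 t
            gcongr
            exact v.norm_coe_le_norm t
      have e2 := Real.one_le_exp (hlam0 t)
      change _ ≤ (‖v‖ + 1) * ρ t * Real.exp (lam t)
      nlinarith [hρ0 t]
    have h2 : Real.exp (-lam x) ≤ 1 := Real.exp_le_one_iff.2 (by linarith [hlam0 x])
    rw [norm_smul, Real.norm_eq_abs, Real.abs_exp]
    calc _ ≤ Real.exp (-lam x) * (‖y‖ + (‖v‖ + 1) / 2 * Real.exp (lam x)) := by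
          gcongr
          exact (norm_add_le _ _).trans (by gcongr)
      _ = Real.exp (-lam x) * ‖y‖ + (‖v‖ + 1) / 2 * (Real.exp (-lam x) * Real.exp (lam x)) := by
          ring
      _ ≤ _ := by
          rw [← Real.exp_add, neg_add_cancel, Real.exp_zero, mul_one]
          gcongr
          exact mul_le_of_le_one_left (norm_nonneg y) h2
  let Φ : BoundedContinuousFunction ℝ E → BoundedContinuousFunction ℝ E := fun v =>
    BoundedContinuousFunction.ofNormedAddCommGroup _ (hcont v) _ (hbd v)
  have hΦ : ContractingWith (1 / 2) Φ := by
    refine ⟨by norm_num, LipschitzWith.of_dist_le_mul fun v v' => ?_⟩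
    rw [BoundedContinuousFunction.dist_le (by positivity)]
    intro x
    have h1 : ‖∫ t in a..x, (G t (Real.exp (lam t) • v t) - G t (Real.exp (lam t) • v' t))‖ ≤
        dist v v' / 2 * Real.exp (lam x) := by
      refine norm_integral_le_exp hρ hρ0 two_pos dist_nonneg fun t _ => ?_
      refine (hLip _ _ _).trans ?_
      rw [← smul_sub, norm_smul, Real.norm_eq_abs, Real.abs_exp, ← dist_eq_norm]
      have := BoundedContinuousFunction.dist_coe_le_dist (f := v) (g := v') t
      have h3 := hρ0 t
      calc _ ≤ ρ t * (Real.exp (lam t) * dist v v') := by gcongr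
        _ = dist v v' * ρ t * Real.exp (lam t) := by ring
    rw [intervalIntegral.integral_sub (intervalIntegrable_of_locallyIntegrable (hG _ (hYc v)) _ _)
      (intervalIntegrable_of_locallyIntegrable (hG _ (hYc v')) _ _)] at h1
    simp only [Φ, BoundedContinuousFunction.coe_ofNormedAddCommGroup]
    rw [dist_eq_norm, ← smul_sub, add_sub_add_left_eq_sub, norm_smul, Real.norm_eq_abs,
      Real.abs_exp]
    calc _ ≤ Real.exp (-lam x) * (dist v v' / 2 * Real.exp (lam x)) := by gcongr
      _ = dist v v' / 2 * (Real.exp (-lam x) * Real.exp (lam x)) := by ring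
      _ = _ := by
        rw [← Real.exp_add, neg_add_cancel, Real.exp_zero]
        push_cast
        ring
  have hfix := hΦ.fixedPoint_isFixedPt
  set v := ContractingWith.fixedPoint Φ hΦ
  refine ⟨fun t => Real.exp (lam t) • v t, hYc v, fun x => ?_⟩
  have h1 : v x = Real.exp (-lam x) • (y + ∫ t in a..x, G t (Real.exp (lam t) • v t)) :=
    (congrArg (fun g : BoundedContinuousFunction ℝ E => g x) hfix).symm
  change Real.exp (lam x) • v x = _
  rw [h1, smul_smul, ← Real.exp_add, add_neg_cancel, Real.exp_zero, one_smul]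

/-- Uniqueness for the initial value problem, on an interval. -/
theorem caratheodory_unique {G : ℝ → E → E} {ρ : ℝ → ℝ} (hρ : LocallyIntegrable ρ)
    (hρ0 : ∀ t, 0 ≤ ρ t) (hLip : ∀ t x y, ‖G t x - G t y‖ ≤ ρ t * ‖x - y‖)
    {a b : ℝ} {Y Z : ℝ → E} (hY : ContinuousOn Y (uIcc a b)) (hZ : ContinuousOn Z (uIcc a b))
    (h : ∀ x ∈ uIcc a b, Y x - Z x = ∫ t in a..x, (G t (Y t) - G t (Z t))) :
    Y b = Z b := by
  have hi := intervalIntegrable_of_locallyIntegrable hρ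
  have hc : Continuous fun x => ∫ s in a..x, ρ s := intervalIntegral.continuous_primitive hi a
  set lam : ℝ → ℝ := fun x => 2 * |∫ s in a..x, ρ s| with hlam
  have hlamc : Continuous lam := by fun_prop
  -- The same weight makes the maximum `M` of the weighted difference satisfy `M ≤ M / 2`.
  obtain ⟨m, hm, hmax⟩ := isCompact_uIcc.exists_isMaxOn (nonempty_uIcc (a := a) (b := b))
    (f := fun x => Real.exp (-lam x) * ‖Y x - Z x‖) (by fun_prop)
  set M := Real.exp (-lam m) * ‖Y m - Z m‖
  have hM0 : 0 ≤ M := by positivity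
  have hle : ∀ t ∈ uIcc a b, ‖Y t - Z t‖ ≤ M * Real.exp (lam t) := fun t ht => by
    have h1 : Real.exp (-lam t) * ‖Y t - Z t‖ ≤ M := hmax ht
    rw [Real.exp_neg, inv_mul_le_iff₀ (Real.exp_pos _)] at h1
    linarith
  have h2 : ‖Y m - Z m‖ ≤ M / 2 * Real.exp (lam m) := by
    rw [h m hm]
    refine norm_integral_le_exp hρ hρ0 two_pos hM0 fun t ht => (hLip _ _ _).trans ?_
    have h3 := hle t (uIcc_subset_uIcc left_mem_uIcc hm ht)
    calc _ ≤ ρ t * (M * Real.exp (lam t)) := by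
          have := hρ0 t
          gcongr
      _ = _ := by ring
  have h4 : M ≤ M / 2 := by
    calc M ≤ Real.exp (-lam m) * (M / 2 * Real.exp (lam m)) := by
          simp only [M]
          gcongr
      _ = M / 2 * (Real.exp (-lam m) * Real.exp (lam m)) := by ring
      _ = M / 2 := by rw [← Real.exp_add, neg_add_cancel, Real.exp_zero, mul_one]
  have h5 := hle b right_mem_uIcc
  have h6 : M = 0 := by linarith
  rw [h6, zero_mul] at h5
  exact sub_eq_zero.1 (norm_le_zero_iff.1 h5)

end Caratheodory

/-! ### Sturm-Liouville equations on the real line -/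

lemma locallyIntegrable_ofReal {Q : ℝ → ℝ} (hQ : LocallyIntegrable Q) :
    LocallyIntegrable fun t => (Q t : ℂ) := fun x =>
  let ⟨s, hs, h⟩ := hQ x
  ⟨s, hs, Integrable.ofReal h⟩

lemma locallyIntegrable_norm {E : Type*} [NormedAddCommGroup E] {f : ℝ → E}
    (hf : LocallyIntegrable f) : LocallyIntegrable fun t => ‖f t‖ := fun x =>
  let ⟨s, hs, h⟩ := hf x
  ⟨s, hs, Integrable.norm h⟩

lemma intervalIntegral_conj (f : ℝ → ℂ) (a b : ℝ) :
    ∫ t in a..b, (starRingEnd ℂ) (f t) = (starRingEnd ℂ) (∫ t in a..b, f t) := by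
  simp only [intervalIntegral, integral_conj, map_sub]

/-- On the whole real line, `u' = w` and `-w' + Q u = F`, in integrated form. -/
structure IsSol (Q : ℝ → ℝ) (F u w : ℝ → ℂ) : Prop where
  hasDerivAt : ∀ x, HasDerivAt u (w x) x
  continuous_deriv : Continuous w
  integral_eq : ∀ a b, ∫ t in a..b, ((Q t : ℂ) * u t - F t) = w b - w a

namespace IsSol

variable {Q : ℝ → ℝ} {F G u w v y : ℝ → ℂ}

lemma continuous (h : IsSol Q F u w) : Continuous u :=
  continuous_iff_continuousAt.2 fun x => (h.hasDerivAt x).continuousAt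

lemma locallyIntegrable (hQ : LocallyIntegrable Q) (hF : LocallyIntegrable F)
    (hu : Continuous u) : LocallyIntegrable fun t => (Q t : ℂ) * u t - F t :=
  (LocallyIntegrable.mul_continuous hu
    (locallyIntegrable_ofReal hQ)).sub hF

lemma congr (h : IsSol Q F u w) (hFG : ∀ x, F x = G x) : IsSol Q G u w := by
  rwa [← funext hFG]

lemma add (hQ : LocallyIntegrable Q) (hF : LocallyIntegrable F) (hG : LocallyIntegrable G)
    (h : IsSol Q F u w) (h' : IsSol Q G v y) :
    IsSol Q (fun x => F x + G x) (fun x => u x + v x) (fun x => w x + y x) where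
  hasDerivAt x := (h.hasDerivAt x).add (h'.hasDerivAt x)
  continuous_deriv := h.continuous_deriv.add h'.continuous_deriv
  integral_eq a b := by
    have e : ∀ t, (Q t : ℂ) * (u t + v t) - (F t + G t) =
        ((Q t : ℂ) * u t - F t) + ((Q t : ℂ) * v t - G t) := fun t => by ring
    simp only [e]
    rw [intervalIntegral.integral_add
      (intervalIntegrable_of_locallyIntegrable (locallyIntegrable hQ hF h.continuous) a b)
      (intervalIntegrable_of_locallyIntegrable (locallyIntegrable hQ hG h'.continuous) a b),
      h.integral_eq, h'.integral_eq]
    ring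

lemma const_mul (h : IsSol Q F u w) (c : ℂ) :
    IsSol Q (fun x => c * F x) (fun x => c * u x) (fun x => c * w x) where
  hasDerivAt x := (h.hasDerivAt x).const_mul c
  continuous_deriv := continuous_const.mul h.continuous_deriv
  integral_eq a b := by
    have e : ∀ t, (Q t : ℂ) * (c * u t) - c * F t = c * ((Q t : ℂ) * u t - F t) :=
      fun t => by ring
    simp only [e]
    rw [intervalIntegral.integral_const_mul, h.integral_eq]
    ring

lemma conj (h : IsSol Q F u w) :
    IsSol Q (fun x => (starRingEnd ℂ) (F x)) (fun x => (starRingEnd ℂ) (u x))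
      (fun x => (starRingEnd ℂ) (w x)) where
  hasDerivAt x := (h.hasDerivAt x).star
  continuous_deriv := Complex.continuous_conj.comp h.continuous_deriv
  integral_eq a b := by
    have e : ∀ t, (Q t : ℂ) * (starRingEnd ℂ) (u t) - (starRingEnd ℂ) (F t) =
        (starRingEnd ℂ) ((Q t : ℂ) * u t - F t) := fun t => by
      simp only [map_sub, map_mul, Complex.conj_ofReal]
    simp only [e]
    rw [intervalIntegral_conj, h.integral_eq, map_sub]

lemma absolutelyContinuous_deriv (hQ : LocallyIntegrable Q) (hF : LocallyIntegrable F)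
    (h : IsSol Q F u w) (a b : ℝ) : AbsolutelyContinuousOnInterval w a b := by
  have h1 := absolutelyContinuous_primitive (intervalIntegrable_of_locallyIntegrable
    (locallyIntegrable hQ hF h.continuous) a b) left_mem_uIcc
  simp only [h.integral_eq] at h1
  simpa [AbsolutelyContinuousOnInterval] using h1

lemma absolutelyContinuous (h : IsSol Q F u w) (a b : ℝ) :
    AbsolutelyContinuousOnInterval u a b := by
  have h1 := absolutelyContinuous_primitive (h.continuous_deriv.intervalIntegrable a b)
    left_mem_uIcc
  have h2 : ∀ x, ∫ t in a..x, w t = u x - u a := fun x =>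
    intervalIntegral.integral_eq_sub_of_hasDerivAt (fun t _ => h.hasDerivAt t)
      (h.continuous_deriv.intervalIntegrable a x)
  simp only [h2] at h1
  simpa [AbsolutelyContinuousOnInterval] using h1

lemma ae_hasDerivAt (hQ : LocallyIntegrable Q) (hF : LocallyIntegrable F) (h : IsSol Q F u w) :
    ∀ᵐ x, HasDerivAt w ((Q x : ℂ) * u x - F x) x := by
  filter_upwards [LocallyIntegrable.ae_hasDerivAt_integral
    (locallyIntegrable hQ hF h.continuous)] with x hx
  have := hx 0
  simp only [h.integral_eq] at this
  simpa using this

/-- The Lagrange identity. -/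
lemma integral_lagrange (hQ : LocallyIntegrable Q) (hF : LocallyIntegrable F)
    (hG : LocallyIntegrable G) (h : IsSol Q F u w) (h' : IsSol Q G v y) (a b : ℝ) :
    ∫ t in a..b, (F t * v t - u t * G t) =
      (u b * y b - w b * v b) - (u a * y a - w a * v a) := by
  -- In the derivative of the Wronskian the two terms containing `Q` cancel. The form is bilinear;
  -- sesquilinear versions arise by inserting a conjugated solution.
  have h1 : AbsolutelyContinuousOnInterval (u • y - w • v) a b :=
    ((h.absolutelyContinuous a b).smul (h'.absolutelyContinuous_deriv hQ hG a b)).sub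
      ((h.absolutelyContinuous_deriv hQ hF a b).smul (h'.absolutelyContinuous a b))
  have h2 : LocallyIntegrable fun t => F t * v t - u t * G t :=
    (LocallyIntegrable.mul_continuous h'.continuous hF).sub
      (LocallyIntegrable.continuous_smul h.continuous hG)
  rw [integral_eq_sub_of_absolutelyContinuous h1
    (intervalIntegrable_of_locallyIntegrable h2 a b)]
  · rfl
  · filter_upwards [h.ae_hasDerivAt hQ hF, h'.ae_hasDerivAt hQ hG] with x hx hx' _
    exact (((h.hasDerivAt x).smul hx').sub (hx.smul (h'.hasDerivAt x))).congr_deriv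
      (by simp only [smul_eq_mul]; ring)

end IsSol

/-! ### Initial value problems through the first order system -/

lemma intervalIntegral_prodMk {f g : ℝ → ℂ} (hf : LocallyIntegrable f) (hg : LocallyIntegrable g)
    (a b : ℝ) : ∫ t in a..b, (f t, g t) = (∫ t in a..b, f t, ∫ t in a..b, g t) := by
  have hi : IntervalIntegrable (fun t => (f t, g t)) volume a b := by
    rw [intervalIntegrable_iff]
    exact (intervalIntegrable_iff.1 (intervalIntegrable_of_locallyIntegrable hf a b)).prodMk
      (intervalIntegrable_iff.1 (intervalIntegrable_of_locallyIntegrable hg a b))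
  have h1 := (ContinuousLinearMap.fst ℝ ℂ ℂ).intervalIntegral_comp_comm hi
  have h2 := (ContinuousLinearMap.snd ℝ ℂ ℂ).intervalIntegral_comp_comm hi
  exact Prod.ext h1.symm h2.symm

/-- The first order system associated with `-u'' + Q u = z u + f`. -/
def field (Q : ℝ → ℝ) (z : ℂ) (f : ℝ → ℂ) (t : ℝ) (p : ℂ × ℂ) : ℂ × ℂ :=
  (p.2, (Q t : ℂ) * p.1 - (z * p.1 + f t))

/-- A locally integrable bound for the vector field `field Q z f`. -/
def fieldBound (Q : ℝ → ℝ) (z : ℂ) (f : ℝ → ℂ) (t : ℝ) : ℝ := 1 + ‖z‖ + ‖Q t‖ + ‖f t‖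

section Field

variable {Q : ℝ → ℝ} {f : ℝ → ℂ}

lemma fieldBound_nonneg (z : ℂ) (t : ℝ) : 0 ≤ fieldBound Q z f t := by
  unfold fieldBound
  positivity

lemma locallyIntegrable_fieldBound (hQ : LocallyIntegrable Q) (hf : LocallyIntegrable f) (z : ℂ) :
    LocallyIntegrable (fieldBound Q z f) :=
  ((locallyIntegrable_const _).add (locallyIntegrable_norm hQ)).add (locallyIntegrable_norm hf)

lemma norm_field_sub_le (z : ℂ) (t : ℝ) (p q : ℂ × ℂ) :
    ‖field Q z f t p - field Q z f t q‖ ≤ fieldBound Q z f t * ‖p - q‖ := by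
  have h1 : ‖p.1 - q.1‖ ≤ ‖p - q‖ := norm_fst_le (p - q)
  have h2 : ‖p.2 - q.2‖ ≤ ‖p - q‖ := norm_snd_le (p - q)
  have h0 : 0 ≤ ‖p - q‖ := norm_nonneg _
  unfold field fieldBound
  rw [Prod.norm_def]
  refine max_le ?_ ?_
  · change ‖p.2 - q.2‖ ≤ _
    nlinarith [norm_nonneg z, norm_nonneg (Q t), norm_nonneg (f t), mul_nonneg (norm_nonneg z) h0,
      mul_nonneg (norm_nonneg (Q t)) h0, mul_nonneg (norm_nonneg (f t)) h0]
  · change ‖(Q t : ℂ) * p.1 - (z * p.1 + f t) - ((Q t : ℂ) * q.1 - (z * q.1 + f t))‖ ≤ _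
    have e : (Q t : ℂ) * p.1 - (z * p.1 + f t) - ((Q t : ℂ) * q.1 - (z * q.1 + f t)) =
        (Q t : ℂ) * (p.1 - q.1) - z * (p.1 - q.1) := by ring
    rw [e]
    calc _ ≤ ‖(Q t : ℂ) * (p.1 - q.1)‖ + ‖z * (p.1 - q.1)‖ := norm_sub_le _ _
      _ = ‖Q t‖ * ‖p.1 - q.1‖ + ‖z‖ * ‖p.1 - q.1‖ := by
          rw [norm_mul, norm_mul, Complex.norm_real]
      _ ≤ ‖Q t‖ * ‖p - q‖ + ‖z‖ * ‖p - q‖ := by gcongr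
      _ ≤ _ := by nlinarith [mul_nonneg (norm_nonneg (f t)) h0]

lemma norm_field_zero_le (z : ℂ) (t : ℝ) : ‖field Q z f t 0‖ ≤ fieldBound Q z f t := by
  unfold field fieldBound
  rw [Prod.norm_def]
  refine max_le ?_ ?_
  · simp only [Prod.snd_zero, norm_zero]
    positivity
  · simp only [Prod.fst_zero, mul_zero, zero_add, zero_sub, norm_neg]
    linarith [norm_nonneg z, norm_nonneg (Q t)]

lemma locallyIntegrable_field_snd (hQ : LocallyIntegrable Q) (hf : LocallyIntegrable f) (z : ℂ)
    {u : ℝ → ℂ} (hu : Continuous u) :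
    LocallyIntegrable fun t => (Q t : ℂ) * u t - (z * u t + f t) :=
  IsSol.locallyIntegrable hQ ((continuous_const.mul hu).locallyIntegrable.add hf) hu

end Field

/-- Existence for the initial value problem. -/
theorem exists_isSol {Q : ℝ → ℝ} {f : ℝ → ℂ} (hQ : LocallyIntegrable Q)
    (hf : LocallyIntegrable f) (z : ℂ) (a : ℝ) (c d : ℂ) :
    ∃ u w, IsSol Q (fun x => z * u x + f x) u w ∧ u a = c ∧ w a = d := by
  obtain ⟨Y, hYc, hY⟩ := exists_caratheodory (G := field Q z f)
    (locallyIntegrable_fieldBound hQ hf z) (fieldBound_nonneg z) (norm_field_sub_le z)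
    (norm_field_zero_le z) (fun Y hY => by
      refine locallyIntegrable_of_intervalIntegrable fun a b => ?_
      rw [intervalIntegrable_iff]
      exact (intervalIntegrable_iff.1 ((continuous_snd.comp hY).intervalIntegrable a b)).prodMk
        (intervalIntegrable_iff.1 (intervalIntegrable_of_locallyIntegrable
          (locallyIntegrable_field_snd hQ hf z (continuous_fst.comp hY)) a b))) a (c, d)
  have h1 : Continuous fun t => (Y t).1 := continuous_fst.comp hYc
  have h2 : Continuous fun t => (Y t).2 := continuous_snd.comp hYc
  have hg := locallyIntegrable_field_snd hQ hf z h1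
  have hY' : ∀ x, Y x = (c + ∫ t in a..x, (Y t).2,
      d + ∫ t in a..x, ((Q t : ℂ) * (Y t).1 - (z * (Y t).1 + f t))) := fun x => by
    rw [hY x]
    unfold field
    rw [intervalIntegral_prodMk h2.locallyIntegrable hg]
    rfl
  refine ⟨fun t => (Y t).1, fun t => (Y t).2, ⟨fun x => ?_, h2, fun s t => ?_⟩, ?_, ?_⟩
  · have := ((h2.integral_hasStrictDerivAt a x).hasDerivAt).const_add c
    refine this.congr_of_eventuallyEq (Eventually.of_forall fun s => ?_)
    exact congrArg Prod.fst (hY' s)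
  · have e : ∀ x, (Y x).2 = d + ∫ t in a..x, ((Q t : ℂ) * (Y t).1 - (z * (Y t).1 + f t)) :=
      fun x => congrArg Prod.snd (hY' x)
    rw [e s, e t, add_sub_add_left_eq_sub, intervalIntegral.integral_interval_sub_left
      (intervalIntegrable_of_locallyIntegrable hg _ _)
      (intervalIntegrable_of_locallyIntegrable hg _ _)]
  · simp [hY' a]
  · simp [hY' a]

/-- Uniqueness for the initial value problem, the equations being required between `a` and `b`. -/
lemma sol_unique {Q : ℝ → ℝ} {f : ℝ → ℂ} (hQ : LocallyIntegrable Q)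
    (hf : LocallyIntegrable f) (z : ℂ) {a b : ℝ} {u w u' w' : ℝ → ℂ}
    (hu : ContinuousOn u (uIcc a b)) (hw : ContinuousOn w (uIcc a b))
    (hu' : ContinuousOn u' (uIcc a b)) (hw' : ContinuousOn w' (uIcc a b))
    (h1 : ∀ x ∈ uIcc a b, u x - u a = ∫ t in a..x, w t)
    (h1' : ∀ x ∈ uIcc a b, u' x - u' a = ∫ t in a..x, w' t)
    (h2 : ∀ x ∈ uIcc a b, w x - w a = ∫ t in a..x, ((Q t : ℂ) * u t - (z * u t + f t)))
    (h2' : ∀ x ∈ uIcc a b, w' x - w' a = ∫ t in a..x, ((Q t : ℂ) * u' t - (z * u' t + f t)))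
    (h : u a = u' a) (h' : w a = w' a) : u b = u' b ∧ w b = w' b := by
  have hQ' := locallyIntegrable_ofReal hQ
  have h_integrable : ∀ (v : ℝ → ℂ), ContinuousOn v (uIcc a b) → ∀ x ∈ uIcc a b,
      IntervalIntegrable (fun t => (Q t : ℂ) * v t - (z * v t + f t)) volume a x := by
    intro v hv x hx
    have hv' := hv.mono (uIcc_subset_uIcc left_mem_uIcc hx)
    exact ((intervalIntegrable_of_locallyIntegrable hQ' a x).mul_continuousOn hv').sub
      ((continuousOn_const.mul hv').intervalIntegrable.add
        (intervalIntegrable_of_locallyIntegrable hf a x))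
  have hcont : ∀ (v : ℝ → ℂ), ContinuousOn v (uIcc a b) → ∀ x ∈ uIcc a b,
      IntervalIntegrable v volume a x := fun v hv x hx =>
    (hv.mono (uIcc_subset_uIcc left_mem_uIcc hx)).intervalIntegrable
  have key := caratheodory_unique (G := field Q z f) (Y := fun t => (u t, w t))
    (Z := fun t => (u' t, w' t)) (locallyIntegrable_fieldBound hQ hf z) (fieldBound_nonneg z)
    (norm_field_sub_le z) (hu.prodMk hw) (hu'.prodMk hw') (fun x hx => ?_)
  · exact ⟨congrArg Prod.fst key, congrArg Prod.snd key⟩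
  · have i1 := (hcont w hw x hx).sub (hcont w' hw' x hx)
    have i2 := (h_integrable u hu x hx).sub (h_integrable u' hu' x hx)
    have hi : IntervalIntegrable (fun t => field Q z f t (u t, w t) - field Q z f t (u' t, w' t))
        volume a x := by
      rw [intervalIntegrable_iff]
      exact (intervalIntegrable_iff.1 i1).prodMk (intervalIntegrable_iff.1 i2)
    have e1 := (ContinuousLinearMap.fst ℝ ℂ ℂ).intervalIntegral_comp_comm hi
    have e2 := (ContinuousLinearMap.snd ℝ ℂ ℂ).intervalIntegral_comp_comm hi
    refine Prod.ext ?_ ?_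
    · refine Eq.trans ?_ e1
      refine Eq.trans ?_ (intervalIntegral.integral_sub (hcont w hw x hx)
        (hcont w' hw' x hx)).symm
      rw [← h1 x hx, ← h1' x hx, h]
      simp
    · refine Eq.trans ?_ e2
      refine Eq.trans ?_ (intervalIntegral.integral_sub (h_integrable u hu x hx)
        (h_integrable u' hu' x hx)).symm
      rw [← h2 x hx, ← h2' x hx, h']
      simp

lemma IsSol.integral_deriv {Q : ℝ → ℝ} {F u w : ℝ → ℂ} (h : IsSol Q F u w) (a b : ℝ) :
    ∫ t in a..b, w t = u b - u a :=
  intervalIntegral.integral_eq_sub_of_hasDerivAt (fun t _ => h.hasDerivAt t)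
    (h.continuous_deriv.intervalIntegrable a b)

/-- Global uniqueness for the initial value problem. -/
lemma IsSol.unique {Q : ℝ → ℝ} {f : ℝ → ℂ} (hQ : LocallyIntegrable Q)
    (hf : LocallyIntegrable f) {z : ℂ} {a : ℝ} {u w u' w' : ℝ → ℂ}
    (h : IsSol Q (fun x => z * u x + f x) u w) (h' : IsSol Q (fun x => z * u' x + f x) u' w')
    (h1 : u a = u' a) (h2 : w a = w' a) (x : ℝ) : u x = u' x ∧ w x = w' x :=
  sol_unique hQ hf z h.continuous.continuousOn h.continuous_deriv.continuousOn
    h'.continuous.continuousOn h'.continuous_deriv.continuousOn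
    (fun s _ => (h.integral_deriv a s).symm) (fun s _ => (h'.integral_deriv a s).symm)
    (fun s _ => (h.integral_eq a s).symm) (fun s _ => (h'.integral_eq a s).symm) h1 h2

/-- A solution on an interval extends to the real line, when the coefficients do. -/
lemma SolvesOn.exists_isSol {I : Set ℝ} (hI : I.OrdConnected) (hIm : MeasurableSet I)
    {V Q : ℝ → ℝ} {z : ℂ} {u w f g : ℝ → ℂ} (hQ : LocallyIntegrable Q) (hg : LocallyIntegrable g)
    (hVQ : ∀ x ∈ I, Q x = V x) (hfg : ∀ᵐ x ∂(volume.restrict I), f x = z * u x + g x)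
    (h : SolvesOn I V u w f) :
    ∃ u' w', IsSol Q (fun x => z * u' x + g x) u' w' ∧ ∀ x ∈ I, u x = u' x ∧ w x = w' x := by
  rcases I.eq_empty_or_nonempty with rfl | ⟨a, ha⟩
  · obtain ⟨u', w', h1, -⟩ := StarGraph.exists_isSol hQ hg z 0 0 0
    exact ⟨u', w', h1, by simp⟩
  -- The global solution with the Cauchy data of `u` at a point of `I` must agree with `u` on `I` by
  -- uniqueness.
  obtain ⟨u', w', h1, hu', hw'⟩ := StarGraph.exists_isSol hQ hg z a (u a) (w a)
  refine ⟨u', w', h1, fun b hb => ?_⟩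
  have hab : uIcc a b ⊆ I := hI.uIcc_subset ha hb
  have hu : ContinuousOn u (uIcc a b) := fun x hx =>
    (h.hasDerivAt x (hab hx)).continuousAt.continuousWithinAt
  have hw : ContinuousOn w (uIcc a b) := (h.absolutelyContinuous a ha b hb).continuousOn
  have hae := h.ae_eq
  rw [ae_restrict_iff' hIm] at hae hfg
  refine sol_unique hQ hg z hu hw h1.continuous.continuousOn h1.continuous_deriv.continuousOn
    (fun s hs => ?_) (fun s _ => (h1.integral_deriv a s).symm) (fun s hs => ?_)
    (fun s _ => (h1.integral_eq a s).symm) hu'.symm hw'.symm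
  · have hsub := uIcc_subset_uIcc left_mem_uIcc hs
    exact (intervalIntegral.integral_eq_sub_of_hasDerivAt
      (fun t ht => h.hasDerivAt t (hab (hsub ht))) (hw.mono hsub).intervalIntegrable).symm
  · have hsub := uIcc_subset_uIcc left_mem_uIcc hs
    refine (integral_eq_sub_of_absolutelyContinuous (h.absolutelyContinuous a ha s (hab hs))
      ?_ ?_).symm
    · exact ((intervalIntegrable_of_locallyIntegrable
        (locallyIntegrable_ofReal hQ) a s).mul_continuousOn (hu.mono hsub)).sub
        ((continuousOn_const.mul (hu.mono hsub)).intervalIntegrable.add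
          (intervalIntegrable_of_locallyIntegrable hg a s))
    · filter_upwards [hae, hfg] with x hx hx' hxs
      have hxI := hab (hsub hxs)
      refine (hx hxI).congr_deriv ?_
      rw [hVQ x hxI, hx' hxI]

/-- The restriction of a global solution to an open set. -/
lemma IsSol.solvesOn {I : Set ℝ} (hIm : MeasurableSet I)
    {V Q : ℝ → ℝ} {u w g : ℝ → ℂ} (hQ : LocallyIntegrable Q) (hg : LocallyIntegrable g)
    (hVQ : ∀ x ∈ I, Q x = V x) (h : IsSol Q g u w) : SolvesOn I V u w g where
  hasDerivAt x _ := h.hasDerivAt x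
  absolutelyContinuous a _ b _ := h.absolutelyContinuous_deriv hQ hg a b
  ae_eq := by
    rw [ae_restrict_iff' hIm]
    filter_upwards [h.ae_hasDerivAt hQ hg] with x hx hxI
    rwa [← hVQ x hxI]

/-! ### The regular boundary value problem on a compact interval -/

/-- The equation `-u'' + Q u = z u + f` on the real line, with `w = u'`. -/
abbrev IsSolAt (Q : ℝ → ℝ) (z : ℂ) (f u w : ℝ → ℂ) : Prop :=
  IsSol Q (fun x => z * u x + f x) u w

lemma locallyIntegrable_rhs {f u : ℝ → ℂ} (z : ℂ) (hf : LocallyIntegrable f)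
    (hu : Continuous u) : LocallyIntegrable fun x => z * u x + f x :=
  (continuous_const.mul hu).locallyIntegrable.add hf

namespace IsSolAt

variable {Q : ℝ → ℝ} {z : ℂ} {f g u w v y φ φ' : ℝ → ℂ}

lemma add (hQ : LocallyIntegrable Q) (hf : LocallyIntegrable f) (hg : LocallyIntegrable g)
    (h : IsSolAt Q z f u w) (h' : IsSolAt Q z g v y) : IsSolAt Q z (f + g) (u + v) (w + y) :=
  (IsSol.add hQ (locallyIntegrable_rhs z hf h.continuous)
    (locallyIntegrable_rhs z hg h'.continuous) h h').congr fun x => by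
      simp only [Pi.add_apply]
      ring

lemma const_smul (h : IsSolAt Q z f u w) (c : ℂ) : IsSolAt Q z (c • f) (c • u) (c • w) :=
  (IsSol.const_mul h c).congr fun x => by
    simp only [Pi.smul_apply, smul_eq_mul]
    ring

lemma add_smul (hQ : LocallyIntegrable Q) (hf : LocallyIntegrable f)
    (h : IsSolAt Q z f u w) (h' : IsSolAt Q z 0 φ φ') (c : ℂ) :
    IsSolAt Q z f (u + c • φ) (w + c • φ') := by
  have h1 := h.add hQ hf (by rw [smul_zero]; exact locallyIntegrable_zero) (h'.const_smul c)
  simpa using h1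

lemma unique (hQ : LocallyIntegrable Q) (hf : LocallyIntegrable f)
    (h : IsSolAt Q z f u w) (h' : IsSolAt Q z f v y) (h1 : u 0 = v 0) (h2 : w 0 = y 0) :
    u = v ∧ w = y :=
  ⟨funext fun x => (IsSol.unique hQ hf h h' h1 h2 x).1,
    funext fun x => (IsSol.unique hQ hf h h' h1 h2 x).2⟩

/-- The imaginary part of the Lagrange identity for `u` and its complex conjugate. -/
lemma integral_energy (hQ : LocallyIntegrable Q) (hf : LocallyIntegrable f)
    (h : IsSolAt Q z f u w) (a b : ℝ) :
    ∫ t in a..b, (z.im * ‖u t‖ ^ 2 + (f t * (starRingEnd ℂ) (u t)).im) =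
      (u b * (starRingEnd ℂ) (w b)).im - (u a * (starRingEnd ℂ) (w a)).im := by
  have hF := locallyIntegrable_rhs z hf h.continuous
  have hFc : LocallyIntegrable fun x => (starRingEnd ℂ) (z * u x + f x) :=
    locallyIntegrable_of_intervalIntegrable fun a b => by
      have := intervalIntegrable_of_locallyIntegrable hF a b
      rw [intervalIntegrable_iff] at this ⊢
      exact (Complex.conjCLE.toContinuousLinearMap).integrable_comp this
  -- As `Q` is real, the conjugate of `u` solves the equation with the same potential and conjugated
  -- right-hand side.
  have h1 := IsSol.integral_lagrange hQ hF hFc h h.conj a b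
  have hi : IntervalIntegrable (fun t => (z * u t + f t) * (starRingEnd ℂ) (u t) -
      u t * (starRingEnd ℂ) (z * u t + f t)) volume a b :=
    intervalIntegrable_of_locallyIntegrable ((LocallyIntegrable.mul_continuous
      h.conj.continuous hF).sub (LocallyIntegrable.continuous_smul h.continuous hFc)) a b
  have h2 := Complex.imCLM.intervalIntegral_comp_comm hi
  rw [h1] at h2
  have h3 : ∀ t, Complex.imCLM ((z * u t + f t) * (starRingEnd ℂ) (u t) -
      u t * (starRingEnd ℂ) (z * u t + f t)) =
      2 * (z.im * ‖u t‖ ^ 2 + (f t * (starRingEnd ℂ) (u t)).im) := by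
    intro t
    rw [← Complex.normSq_eq_norm_sq, Complex.normSq_apply]
    simp only [Complex.imCLM_apply, Complex.sub_im, Complex.mul_im, Complex.add_im,
      Complex.add_re, Complex.mul_re, Complex.conj_re, Complex.conj_im]
    ring
  simp only [h3] at h2
  rw [intervalIntegral.integral_const_mul] at h2
  have h4 : Complex.imCLM (u b * (starRingEnd ℂ) (w b) - w b * (starRingEnd ℂ) (u b) -
      (u a * (starRingEnd ℂ) (w a) - w a * (starRingEnd ℂ) (u a))) =
      2 * ((u b * (starRingEnd ℂ) (w b)).im - (u a * (starRingEnd ℂ) (w a)).im) := by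
    simp only [Complex.imCLM_apply, Complex.sub_im, Complex.mul_im, Complex.conj_re,
      Complex.conj_im]
    ring
  rw [h4] at h2
  linarith

end IsSolAt

/-- Two vectors satisfying the same real boundary condition are linearly dependent. -/
lemma wronskian_eq_zero_of_boundary {c d c' d' : ℂ} {ω : ℝ}
    (h : c * (Real.cos ω : ℂ) + d * (Real.sin ω : ℂ) = 0)
    (h' : c' * (Real.cos ω : ℂ) + d' * (Real.sin ω : ℂ) = 0) : c * d' - d * c' = 0 := by
  have h1 : (Real.cos ω : ℂ) ^ 2 + (Real.sin ω : ℂ) ^ 2 = 1 := by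
    norm_cast
    exact Real.cos_sq_add_sin_sq ω
  have h2 : (c * d' - d * c') * ((Real.cos ω : ℂ) ^ 2 + (Real.sin ω : ℂ) ^ 2) = 0 := by
    linear_combination (d' * (Real.cos ω : ℂ) - c' * (Real.sin ω : ℂ)) * h +
      (c * (Real.sin ω : ℂ) - d * (Real.cos ω : ℂ)) * h'
  rwa [h1, mul_one] at h2

lemma conj_boundary {c d : ℂ} {ω : ℝ}
    (h : c * (Real.cos ω : ℂ) + d * (Real.sin ω : ℂ) = 0) :
    (starRingEnd ℂ) c * (Real.cos ω : ℂ) + (starRingEnd ℂ) d * (Real.sin ω : ℂ) = 0 := by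
  have := congrArg (starRingEnd ℂ) h
  simpa only [map_add, map_mul, Complex.conj_ofReal, map_zero] using this

/-- A real condition is also satisfied by the conjugate vector, so the two are dependent. This
removes the boundary term at a finite end from the energy identity. -/
lemma im_mul_conj_eq_zero_of_boundary {c d : ℂ} {ω : ℝ}
    (h : c * (Real.cos ω : ℂ) + d * (Real.sin ω : ℂ) = 0) : (c * (starRingEnd ℂ) d).im = 0 := by
  have h1 := congrArg Complex.im (wronskian_eq_zero_of_boundary h (conj_boundary h))
  simp only [Complex.sub_im, Complex.mul_im, Complex.conj_re, Complex.conj_im,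
    Complex.zero_im] at h1 ⊢
  linarith

/-- A solution with nontrivial Cauchy data at `0` has positive norm near `0`. -/
lemma IsSol.integral_norm_sq_pos {Q : ℝ → ℝ} {F u w : ℝ → ℂ} (h : IsSol Q F u w)
    (h0 : u 0 ≠ 0 ∨ w 0 ≠ 0) {b : ℝ} (hb : 0 < b) : 0 < ∫ t in (0 : ℝ)..b, ‖u t‖ ^ 2 := by
  have hc := h.continuous
  refine intervalIntegral.integral_pos hb (by fun_prop) (fun x _ => by positivity) ?_
  by_contra! hcon
  have hz : ∀ x ∈ Icc 0 b, u x = 0 := fun x hx => by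
    have := le_antisymm (hcon x hx) (by positivity)
    simpa using this
  have h00 := hz 0 ⟨le_rfl, hb.le⟩
  -- Vanishing is known only to the right of `0`, so the derivative there is identified within the
  -- interval.
  have hd : HasDerivWithinAt u 0 (Icc 0 b) 0 :=
    (hasDerivWithinAt_const (0 : ℝ) (Icc 0 b) (0 : ℂ)).congr hz h00
  have := (uniqueDiffOn_Icc hb 0 ⟨le_rfl, hb.le⟩).eq_deriv _ (h.hasDerivAt 0).hasDerivWithinAt hd
  exact h0.elim (fun h => h h00) (fun h => h this)

section Regular

variable {Q : ℝ → ℝ} {z : ℂ} {f θ θ' φ φ' p p' : ℝ → ℂ}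

/-- A nonreal `z` is not an eigenvalue of the regular problem: otherwise both boundary terms of the
energy identity vanish, forcing `Im z * ∫ ‖φ‖² = 0`. -/
lemma boundary_ne_zero (hQ : LocallyIntegrable Q) (hz : z.im ≠ 0) (hφ : IsSolAt Q z 0 φ φ')
    (h0 : φ 0 = 0) (h1 : φ' 0 = 1) {b : ℝ} (hb : 0 < b) (ω : ℝ) :
    φ b * (Real.cos ω : ℂ) + φ' b * (Real.sin ω : ℂ) ≠ 0 := by
  intro h
  have h2 := hφ.integral_energy hQ locallyIntegrable_zero 0 b
  rw [im_mul_conj_eq_zero_of_boundary h, h0] at h2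
  simp only [zero_mul, Complex.zero_im, add_zero, sub_zero,
    intervalIntegral.integral_const_mul, mul_eq_zero, hz, false_or] at h2
  exact (IsSol.integral_norm_sq_pos hφ (Or.inr (by simp [h1])) hb).ne' h2

lemma exists_boundary_coeff (hQ : LocallyIntegrable Q) (hz : z.im ≠ 0) (hφ : IsSolAt Q z 0 φ φ')
    (h0 : φ 0 = 0) (h1 : φ' 0 = 1) (p p' : ℝ → ℂ) {b : ℝ} (hb : 0 < b) (ω : ℝ) :
    ∃ m : ℂ, (p + m • φ) b * (Real.cos ω : ℂ) + (p' + m • φ') b * (Real.sin ω : ℂ) = 0 := by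
  have hne := boundary_ne_zero hQ hz hφ h0 h1 hb ω
  refine ⟨-(p b * (Real.cos ω : ℂ) + p' b * (Real.sin ω : ℂ)) /
    (φ b * (Real.cos ω : ℂ) + φ' b * (Real.sin ω : ℂ)), ?_⟩
  have := div_mul_cancel₀ (-(p b * (Real.cos ω : ℂ) + p' b * (Real.sin ω : ℂ))) hne
  simp only [Pi.add_apply, Pi.smul_apply, smul_eq_mul]
  linear_combination this

/-- The Weyl solution of the regular problem on `[0, b]`. -/
lemma exists_regular_weyl (hQ : LocallyIntegrable Q) (hz : z.im ≠ 0) (hφ : IsSolAt Q z 0 φ φ')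
    (h0 : φ 0 = 0) (h1 : φ' 0 = 1) (hθ : IsSolAt Q z 0 θ θ') (hθ0 : θ 0 = 1) (hθ1 : θ' 0 = 0)
    {b : ℝ} (hb : 0 < b) (ω : ℝ) :
    ∃ m : ℂ, (θ + m • φ) b * (Real.cos ω : ℂ) + (θ' + m • φ') b * (Real.sin ω : ℂ) = 0 ∧
      m.im = z.im * ∫ t in (0 : ℝ)..b, ‖(θ + m • φ) t‖ ^ 2 := by
  obtain ⟨m, hbc⟩ := exists_boundary_coeff hQ hz hφ h0 h1 θ θ' hb ω
  refine ⟨m, hbc, ?_⟩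
  have h2 := (hθ.add_smul hQ locallyIntegrable_zero hφ m).integral_energy hQ
    locallyIntegrable_zero 0 b
  rw [im_mul_conj_eq_zero_of_boundary hbc] at h2
  simpa [h0, h1, hθ0, hθ1] using h2.symm

/-- The resolvent of the regular problem on `[0, b]`, with a Dirichlet condition at `0`. -/
lemma exists_regular_resolvent (hQ : LocallyIntegrable Q) (hz : z.im ≠ 0)
    (hf : LocallyIntegrable f) {b : ℝ} (i2 : IntervalIntegrable (fun x => ‖f x‖ ^ 2) volume 0 b)
    (hφ : IsSolAt Q z 0 φ φ') (h0 : φ 0 = 0) (h1 : φ' 0 = 1) (hp : IsSolAt Q z f p p')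
    (hp0 : p 0 = 0) (hb : 0 < b) (ω : ℝ) :
    ∃ c : ℂ, (p + c • φ) b * (Real.cos ω : ℂ) + (p' + c • φ') b * (Real.sin ω : ℂ) = 0 ∧
      z.im ^ 2 * ∫ t in (0 : ℝ)..b, ‖(p + c • φ) t‖ ^ 2 ≤ ∫ t in (0 : ℝ)..b, ‖f t‖ ^ 2 := by
  obtain ⟨m, hbc⟩ := exists_boundary_coeff hQ hz hφ h0 h1 p p' hb ω
  refine ⟨m, hbc, ?_⟩
  have hs := hp.add_smul hQ hf hφ m
  have h2 := hs.integral_energy hQ hf 0 b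
  rw [im_mul_conj_eq_zero_of_boundary hbc] at h2
  have hu0 : (p + m • φ) 0 = 0 := by simp [h0, hp0]
  rw [hu0, zero_mul, Complex.zero_im, sub_zero] at h2
  set u := p + m • φ with hu
  have hc : Continuous u := hs.continuous
  have i1 : IntervalIntegrable (fun t => ‖u t‖ ^ 2) volume 0 b :=
    Continuous.intervalIntegrable (by fun_prop) _ _
  have i3 : IntervalIntegrable (fun t => (f t * (starRingEnd ℂ) (u t)).im) volume 0 b := by
    have := intervalIntegrable_of_locallyIntegrable
      (LocallyIntegrable.mul_continuous (Complex.continuous_conj.comp hc) hf) 0 b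
    rw [intervalIntegrable_iff] at this ⊢
    exact Complex.imCLM.integrable_comp this
  -- By `h2` the left side equals `(Im z)² ∫ ‖u‖²`. Young's inequality is weighted so that half of
  -- this quantity is absorbed.
  have h3 : ∫ t in (0 : ℝ)..b, (-z.im) * (f t * (starRingEnd ℂ) (u t)).im ≤
      ∫ t in (0 : ℝ)..b, ((1 / 2) * ‖f t‖ ^ 2 + (z.im ^ 2 / 2) * ‖u t‖ ^ 2) := by
    refine intervalIntegral.integral_mono_on hb.le (i3.const_mul _)
      ((i2.const_mul _).add (i1.const_mul _)) fun t _ => ?_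
    have e1 : |(f t * (starRingEnd ℂ) (u t)).im| ≤ ‖f t‖ * ‖u t‖ := by
      refine (Complex.abs_im_le_norm _).trans ?_
      rw [norm_mul, Complex.norm_conj]
    have e2 : (-z.im) * (f t * (starRingEnd ℂ) (u t)).im ≤ |z.im| * (‖f t‖ * ‖u t‖) := by
      refine (le_abs_self _).trans ?_
      rw [abs_mul, abs_neg]
      gcongr
    nlinarith [sq_nonneg (‖f t‖ - |z.im| * ‖u t‖), sq_abs z.im]
  rw [intervalIntegral.integral_add (i2.const_mul _) (i1.const_mul _),
    intervalIntegral.integral_const_mul, intervalIntegral.integral_const_mul,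
    intervalIntegral.integral_const_mul] at h3
  rw [intervalIntegral.integral_add (i1.const_mul _) i3, intervalIntegral.integral_const_mul] at h2
  rw [eq_neg_of_add_eq_zero_right h2] at h3
  nlinarith

end Regular

/-! ### Approximation on the half-line by regular problems -/

/-- All bounded sequences converge along one fixed ultrafilter, so different approximations can be
compared index by index without extracting common subsequences. -/
lemma exists_tendsto_hyperfilter {c : ℕ → ℂ} {R : ℝ} (h : ∀ n, ‖c n‖ ≤ R) :
    ∃ a : ℂ, Tendsto c (hyperfilter ℕ : Filter ℕ) (𝓝 a) := by
  obtain ⟨a, -, ha⟩ := (isCompact_closedBall (0 : ℂ) R).ultrafilter_le_nhds'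
    ((hyperfilter ℕ).map c) (by
      refine Ultrafilter.mem_map.2 (Filter.univ_mem' fun n => ?_)
      simpa using h n)
  exact ⟨a, ha⟩

lemma eventually_hyperfilter_le (B : ℝ) :
    ∀ᶠ n : ℕ in (hyperfilter ℕ : Filter ℕ), B ≤ (n : ℝ) + 1 := by
  refine Nat.hyperfilter_le_atTop ?_
  filter_upwards [tendsto_natCast_atTop_atTop.eventually_ge_atTop B] with n hn
  linarith

lemma norm_sq_add_le (a b : ℂ) : ‖a + b‖ ^ 2 ≤ 2 * ‖a‖ ^ 2 + 2 * ‖b‖ ^ 2 := by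
  have h := norm_add_le a b
  nlinarith [sq_nonneg (‖a‖ - ‖b‖), norm_nonneg (a + b)]

lemma integral_norm_sq_add_le {u v : ℝ → ℂ} (hu : Continuous u) (hv : Continuous v) {a b : ℝ}
    (hab : a ≤ b) : ∫ t in a..b, ‖(u + v) t‖ ^ 2 ≤
      2 * (∫ t in a..b, ‖u t‖ ^ 2) + 2 * ∫ t in a..b, ‖v t‖ ^ 2 := by
  rw [← intervalIntegral.integral_const_mul, ← intervalIntegral.integral_const_mul,
    ← intervalIntegral.integral_add (Continuous.intervalIntegrable (by fun_prop) _ _)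
      (Continuous.intervalIntegrable (by fun_prop) _ _)]
  exact intervalIntegral.integral_mono_on hab (Continuous.intervalIntegrable (by fun_prop) _ _)
    (Continuous.intervalIntegrable (by fun_prop) _ _) fun t _ => norm_sq_add_le _ _

lemma integral_norm_sq_smul (c : ℂ) (u : ℝ → ℂ) (a b : ℝ) :
    ∫ t in a..b, ‖(c • u) t‖ ^ 2 = ‖c‖ ^ 2 * ∫ t in a..b, ‖u t‖ ^ 2 := by
  simp only [Pi.smul_apply, norm_smul, mul_pow, intervalIntegral.integral_const_mul]

lemma integral_norm_sq_mono {u : ℝ → ℂ} (hu : Continuous u) {a b c d : ℝ}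
    (hca : c ≤ a) (hab : a ≤ b) (hbd : b ≤ d) :
    ∫ t in a..b, ‖u t‖ ^ 2 ≤ ∫ t in c..d, ‖u t‖ ^ 2 :=
  intervalIntegral.integral_mono_interval hca hab hbd
    (Eventually.of_forall fun t => by positivity)
    (Continuous.intervalIntegrable (by fun_prop) _ _)

/-- The solution `u` of `-u'' + Q u = z u + f` is a limit of solutions of the same equation which
vanish at `n + 1` and are bounded in `L²(0, n + 1)`, the correction being a multiple of `φ`. -/
structure IsApproximable (Q : ℝ → ℝ) (z : ℂ) (φ f u w : ℝ → ℂ) : Prop where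
  isSolAt : IsSolAt Q z f u w
  exists_seq : ∃ (c : ℕ → ℂ) (C : ℝ), Tendsto c (hyperfilter ℕ : Filter ℕ) (𝓝 0) ∧
    ∀ n : ℕ, (u + c n • φ) ((n : ℝ) + 1) = 0 ∧
      ∫ t in (0 : ℝ)..((n : ℝ) + 1), ‖(u + c n • φ) t‖ ^ 2 ≤ C

section HalfLine

variable {Q : ℝ → ℝ} {z : ℂ} {f g φ φ' u w v y : ℝ → ℂ}

lemma IsApproximable.add_smul (hQ : LocallyIntegrable Q) (hf : LocallyIntegrable f)
    (hφ : IsSolAt Q z 0 φ φ') (h : IsApproximable Q z φ f u w)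
    (h' : IsApproximable Q z φ 0 v y) (k : ℂ) :
    IsApproximable Q z φ f (u + k • v) (w + k • y) := by
  have hcφ := hφ.continuous
  have hcu := h.isSolAt.continuous
  have hcv := h'.isSolAt.continuous
  obtain ⟨c, C, hc, hC⟩ := h.exists_seq
  obtain ⟨d, D, hd, hD⟩ := h'.exists_seq
  refine ⟨h.isSolAt.add_smul hQ hf h'.isSolAt k, fun n => c n + k * d n,
    2 * C + 2 * (‖k‖ ^ 2 * D), ?_, fun n => ?_⟩
  · simpa using hc.add (hd.const_mul k)
  · have e : u + k • v + (c n + k * d n) • φ = (u + c n • φ) + k • (v + d n • φ) := by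
      rw [_root_.add_smul, mul_smul, smul_add]
      abel
    rw [e]
    constructor
    · rw [Pi.add_apply, Pi.smul_apply, (hC n).1, (hD n).1, smul_zero, add_zero]
    · refine (integral_norm_sq_add_le (by fun_prop) (by fun_prop) (by positivity)).trans ?_
      rw [integral_norm_sq_smul]
      have h1 := (hC n).2
      have h2 := (hD n).2
      gcongr

lemma memLp_of_integral_bounded (hu : Continuous u) {C : ℝ}
    (h : ∀ b : ℝ, 0 ≤ b → ∫ t in (0 : ℝ)..b, ‖u t‖ ^ 2 ≤ C) :
    MemLp u 2 (volume.restrict (Ioi 0)) := by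
  rw [memLp_two_iff_integrable_sq_norm hu.aestronglyMeasurable]
  refine integrableOn_Ioi_of_intervalIntegral_norm_bounded C 0 (l := atTop) (b := id)
    (fun i => ?_) tendsto_id ?_
  · exact (Continuous.integrableOn_Ioc (by fun_prop))
  · filter_upwards [eventually_ge_atTop 0] with b hb
    simpa using h b hb

/-- On a fixed `[0, b]` the corrections `c n • φ` tend to zero, so the uniform bound `C` for the
approximants yields `∫ ‖u‖² ≤ 2 * C` there, independently of `b`. -/
lemma IsApproximable.memLp (hφ : IsSolAt Q z 0 φ φ') (h : IsApproximable Q z φ f u w) :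
    MemLp u 2 (volume.restrict (Ioi 0)) := by
  have hcφ := hφ.continuous
  have hcu := h.isSolAt.continuous
  obtain ⟨c, C, hc, hC⟩ := h.exists_seq
  refine memLp_of_integral_bounded (C := 2 * C) hcu fun b hb => ?_
  have h1 : Tendsto (fun n => 2 * C + 2 * (‖c n‖ ^ 2 * ∫ t in (0 : ℝ)..b, ‖φ t‖ ^ 2))
      (hyperfilter ℕ : Filter ℕ) (𝓝 (2 * C + 2 * (‖(0 : ℂ)‖ ^ 2 * ∫ t in (0 : ℝ)..b, ‖φ t‖ ^ 2))) :=
    (((hc.norm.pow 2).mul_const _).const_mul 2).const_add _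
  simp only [norm_zero, ne_eq, OfNat.ofNat_ne_zero, not_false_eq_true, zero_pow, zero_mul,
    mul_zero, add_zero] at h1
  refine ge_of_tendsto h1 ?_
  filter_upwards [eventually_hyperfilter_le b] with n hn
  have e : u = (u + c n • φ) + (-c n) • φ := by
    rw [neg_smul]
    abel
  conv_lhs => rw [e]
  refine (integral_norm_sq_add_le (by fun_prop) (by fun_prop) hb).trans ?_
  rw [integral_norm_sq_smul, norm_neg]
  have h2 := (integral_norm_sq_mono (u := u + c n • φ) (by fun_prop) le_rfl hb hn).trans (hC n).2
  gcongr

lemma intervalIntegrable_of_integrableOn_Ioi {h : ℝ → ℝ} (hh : IntegrableOn h (Ioi 0)) {a b : ℝ}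
    (ha : 0 ≤ a) (hab : a ≤ b) : IntervalIntegrable h volume a b :=
  (intervalIntegrable_iff_integrableOn_Ioc_of_le hab).2
    (hh.mono_set fun _ hx => lt_of_le_of_lt ha hx.1)

lemma integral_le_tail (hf : IntegrableOn (fun x => ‖f x‖ ^ 2) (Ioi 0)) {B b : ℝ} (hB : 0 ≤ B)
    (hb : B ≤ b) : ∫ t in B..b, ‖f t‖ ^ 2 ≤
      (∫ t in Ioi (0 : ℝ), ‖f t‖ ^ 2) - ∫ t in (0 : ℝ)..B, ‖f t‖ ^ 2 := by
  have h1 : ∫ t in (0 : ℝ)..b, ‖f t‖ ^ 2 ≤ ∫ t in Ioi (0 : ℝ), ‖f t‖ ^ 2 := by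
    rw [intervalIntegral.integral_of_le (hB.trans hb)]
    exact setIntegral_mono_set hf (Eventually.of_forall fun t => by positivity)
      (Ioc_subset_Ioi_self.eventuallyLE)
  have h2 := intervalIntegral.integral_add_adjacent_intervals
    (intervalIntegrable_of_integrableOn_Ioi hf le_rfl hB)
    (intervalIntegrable_of_integrableOn_Ioi hf hB hb)
  linarith

lemma tendsto_tail (hf : IntegrableOn (fun x => ‖f x‖ ^ 2) (Ioi 0)) :
    Tendsto (fun B => (∫ t in Ioi (0 : ℝ), ‖f t‖ ^ 2) - ∫ t in (0 : ℝ)..B, ‖f t‖ ^ 2) atTop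
      (𝓝 0) := by
  have := (intervalIntegral_tendsto_integral_Ioi 0 hf tendsto_id).const_sub
    (∫ t in Ioi (0 : ℝ), ‖f t‖ ^ 2)
  simpa using this

/-- Both solutions vanish at `b`, so up to sign the Wronskian at `B` is `∫ (f v - u g)` over `[B,
b]`; the terms with `z` cancel. Young's inequality with parameter `ε` separates the bounded norms of
`u` and `v` from the tails of `f` and `g`. The bound involves `b` only through `C` and `D`. -/
lemma norm_wronskian_le (hQ : LocallyIntegrable Q) (hf : LocallyIntegrable f)
    (hg : LocallyIntegrable g) (hf2 : IntegrableOn (fun x => ‖f x‖ ^ 2) (Ioi 0))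
    (hg2 : IntegrableOn (fun x => ‖g x‖ ^ 2) (Ioi 0)) (h : IsSolAt Q z f u w) (h' : IsSolAt Q z g v y)
    {B b C D ε : ℝ} (hB : 0 ≤ B) (hb : B ≤ b) (hε : 0 < ε) (hu : u b = 0) (hv : v b = 0)
    (hC : ∫ t in (0 : ℝ)..b, ‖u t‖ ^ 2 ≤ C) (hD : ∫ t in (0 : ℝ)..b, ‖v t‖ ^ 2 ≤ D) :
    ‖u B * y B - w B * v B‖ ≤ ε * (C + D) + (1 / ε) *
      (((∫ t in Ioi (0 : ℝ), ‖f t‖ ^ 2) - ∫ t in (0 : ℝ)..B, ‖f t‖ ^ 2) +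
        ((∫ t in Ioi (0 : ℝ), ‖g t‖ ^ 2) - ∫ t in (0 : ℝ)..B, ‖g t‖ ^ 2)) := by
  have hcu := h.continuous
  have hcv := h'.continuous
  have h1 := IsSol.integral_lagrange hQ (locallyIntegrable_rhs z hf hcu)
    (locallyIntegrable_rhs z hg hcv) h h' B b
  rw [hu, hv, zero_mul, mul_zero, sub_zero, zero_sub] at h1
  rw [← norm_neg, ← h1]
  have iu : IntervalIntegrable (fun t => ‖u t‖ ^ 2) volume B b :=
    Continuous.intervalIntegrable (by fun_prop) _ _
  have iv : IntervalIntegrable (fun t => ‖v t‖ ^ 2) volume B b :=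
    Continuous.intervalIntegrable (by fun_prop) _ _
  have i_f : IntervalIntegrable (fun t => ‖f t‖ ^ 2) volume B b :=
    intervalIntegrable_of_integrableOn_Ioi hf2 hB hb
  have ig : IntervalIntegrable (fun t => ‖g t‖ ^ 2) volume B b :=
    intervalIntegrable_of_integrableOn_Ioi hg2 hB hb
  have h2 : ‖∫ t in B..b, ((z * u t + f t) * v t - u t * (z * v t + g t))‖ ≤
      ∫ t in B..b, (ε * (‖u t‖ ^ 2 + ‖v t‖ ^ 2) + (1 / ε) * (‖f t‖ ^ 2 + ‖g t‖ ^ 2)) := by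
    refine intervalIntegral.norm_integral_le_of_norm_le hb (Eventually.of_forall fun t _ => ?_)
      (((iu.add iv).const_mul ε).add ((i_f.add ig).const_mul _))
    have e : (z * u t + f t) * v t - u t * (z * v t + g t) = f t * v t - u t * g t := by ring
    have amgm : ∀ a b : ℝ, a * b ≤ ε * b ^ 2 + (1 / ε) * a ^ 2 := fun a b => by
      have e1 : ε * b ^ 2 + (1 / ε) * a ^ 2 - a * b =
          ((ε * b) ^ 2 + (ε * b - a) ^ 2 + a ^ 2) / (2 * ε) := by
        field_simp
        ring
      have : 0 ≤ ((ε * b) ^ 2 + (ε * b - a) ^ 2 + a ^ 2) / (2 * ε) := by positivity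
      linarith
    rw [e]
    calc _ ≤ ‖f t * v t‖ + ‖u t * g t‖ := norm_sub_le _ _
      _ = ‖f t‖ * ‖v t‖ + ‖g t‖ * ‖u t‖ := by rw [norm_mul, norm_mul, mul_comm ‖u t‖]
      _ ≤ _ := by linarith [amgm ‖f t‖ ‖v t‖, amgm ‖g t‖ ‖u t‖]
  refine h2.trans ?_
  rw [intervalIntegral.integral_add ((iu.add iv).const_mul ε) ((i_f.add ig).const_mul _),
    intervalIntegral.integral_const_mul, intervalIntegral.integral_const_mul,
    intervalIntegral.integral_add iu iv, intervalIntegral.integral_add i_f ig]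
  have e1 := (integral_norm_sq_mono hcu hB hb le_rfl).trans hC
  have e2 := (integral_norm_sq_mono hcv hB hb le_rfl).trans hD
  have e3 := integral_le_tail hf2 hB hb
  have e4 := integral_le_tail hg2 hB hb
  gcongr

/-- The Wronskian of two approximable solutions vanishes at infinity. -/
lemma IsApproximable.tendsto_wronskian (hQ : LocallyIntegrable Q) (hf : LocallyIntegrable f)
    (hg : LocallyIntegrable g) (hf2 : IntegrableOn (fun x => ‖f x‖ ^ 2) (Ioi 0))
    (hg2 : IntegrableOn (fun x => ‖g x‖ ^ 2) (Ioi 0)) (hφ : IsSolAt Q z 0 φ φ')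
    (h : IsApproximable Q z φ f u w) (h' : IsApproximable Q z φ g v y) :
    Tendsto (fun x => u x * y x - w x * v x) atTop (𝓝 0) := by
  obtain ⟨c, C, hc, hC⟩ := h.exists_seq
  obtain ⟨d, D, hd, hD⟩ := h'.exists_seq
  set T : ℝ → ℝ := fun B => ((∫ t in Ioi (0 : ℝ), ‖f t‖ ^ 2) - ∫ t in (0 : ℝ)..B, ‖f t‖ ^ 2) +
        ((∫ t in Ioi (0 : ℝ), ‖g t‖ ^ 2) - ∫ t in (0 : ℝ)..B, ‖g t‖ ^ 2) with hT
  have hT0 : Tendsto T atTop (𝓝 0) := by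
    simpa using (tendsto_tail hf2).add (tendsto_tail hg2)
  have key : ∀ B, 0 ≤ B → ∀ ε > 0, ‖u B * y B - w B * v B‖ ≤ ε * (C + D) + (1 / ε) * T B := by
    intro B hB ε hε
    have lim : Tendsto (fun n => ‖(u + c n • φ) B * (y + d n • φ') B -
        (w + c n • φ') B * (v + d n • φ) B‖) (hyperfilter ℕ : Filter ℕ)
        (𝓝 ‖u B * y B - w B * v B‖) := by
      have e : ∀ (a : ℕ → ℂ) (p q : ℂ), Tendsto a (hyperfilter ℕ : Filter ℕ) (𝓝 0) →
          Tendsto (fun n => p + a n * q) (hyperfilter ℕ : Filter ℕ) (𝓝 p) := fun a p q ha => by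
        simpa using (ha.mul_const q).const_add p
      exact (((e c _ _ hc).mul (e d _ _ hd)).sub ((e c _ _ hc).mul (e d _ _ hd))).norm
    refine le_of_tendsto lim ?_
    filter_upwards [eventually_hyperfilter_le B] with n hn
    exact norm_wronskian_le hQ hf hg hf2 hg2 (h.isSolAt.add_smul hQ hf hφ (c n))
      (h'.isSolAt.add_smul hQ hg hφ (d n)) hB hn hε (hC n).1 (hD n).1 (hC n).2 (hD n).2
  have hCD : 0 ≤ C + D := by
    have h1 : 0 ≤ C := (intervalIntegral.integral_nonneg (by positivity)
      fun t _ => by positivity).trans (hC 0).2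
    have h2 : 0 ≤ D := (intervalIntegral.integral_nonneg (by positivity)
      fun t _ => by positivity).trans (hD 0).2
    linarith
  rw [tendsto_zero_iff_norm_tendsto_zero]
  rw [Metric.tendsto_nhds]
  intro δ hδ
  -- This puts the first term of `key` below `δ / 2`; the `+ 1` allows `C + D = 0`.
  set ε := δ / (2 * (C + D + 1)) with hε
  have hε0 : 0 < ε := by positivity
  have h1 : ε * (C + D) < δ / 2 := by
    rw [hε, div_mul_eq_mul_div, div_lt_div_iff₀ (by positivity) two_pos]
    nlinarith
  have h2 : Tendsto (fun B => (1 / ε) * T B) atTop (𝓝 0) := by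
    simpa using hT0.const_mul (1 / ε)
  filter_upwards [eventually_ge_atTop 0, h2.eventually_lt_const (half_pos hδ)] with B hB hB'
  rw [Real.dist_0_eq_abs, abs_norm]
  linarith [key B hB ε hε0]

end HalfLine

/-! ### Half-line resolvent, Weyl solution and the limit point case -/

section HalfLine

variable {Q : ℝ → ℝ} {z : ℂ} {f φ φ' θ θ' u w : ℝ → ℂ}

/-- Write `c • φ = (p + c • φ) - p` on `[0, 1]`. Since `φ` has positive norm there, bounds on the
approximants bound their coefficients. -/
lemma integral_norm_sq_coeff_le {p : ℝ → ℂ} (hp : Continuous p) (hφ : Continuous φ) (c : ℂ)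
    {b : ℝ} (hb : 1 ≤ b) : ‖c‖ ^ 2 * ∫ t in (0 : ℝ)..1, ‖φ t‖ ^ 2 ≤
      2 * (∫ t in (0 : ℝ)..b, ‖(p + c • φ) t‖ ^ 2) + 2 * ∫ t in (0 : ℝ)..1, ‖p t‖ ^ 2 := by
  have e : c • φ = (p + c • φ) + -p := by abel
  rw [← integral_norm_sq_smul]
  conv_lhs => rw [e]
  refine (integral_norm_sq_add_le (by fun_prop) (by fun_prop) zero_le_one).trans ?_
  simp only [Pi.neg_apply, norm_neg]
  have := integral_norm_sq_mono (u := p + c • φ) (by fun_prop) le_rfl zero_le_one hb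
  gcongr

lemma IsApproximable.of_tendsto {p p' : ℝ → ℂ} (hQ : LocallyIntegrable Q)
    (hf : LocallyIntegrable f) (hφ : IsSolAt Q z 0 φ φ') (hp : IsSolAt Q z f p p')
    {c : ℕ → ℂ} {a : ℂ} (hc : Tendsto c (hyperfilter ℕ : Filter ℕ) (𝓝 a))
    (h0 : ∀ n : ℕ, (p + c n • φ) ((n : ℝ) + 1) = 0) {C : ℝ}
    (hC : ∀ n : ℕ, ∫ t in (0 : ℝ)..((n : ℝ) + 1), ‖(p + c n • φ) t‖ ^ 2 ≤ C) :
    IsApproximable Q z φ f (p + a • φ) (p' + a • φ') := by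
  refine ⟨hp.add_smul hQ hf hφ a, fun n => c n - a, C, ?_, fun n => ?_⟩
  · simpa using hc.sub_const a
  · have e : p + a • φ + (c n - a) • φ = p + c n • φ := by
      rw [sub_smul]
      abel
    rw [e]
    exact ⟨h0 n, hC n⟩

/-- Solvability of `-u'' + Q u = z u + f` in `L²(0, ∞)`, with a Dirichlet condition at `0`. -/
lemma exists_approximable_resolvent (hQ : LocallyIntegrable Q) (hz : z.im ≠ 0)
    (hf : LocallyIntegrable f) (hf2 : IntegrableOn (fun x => ‖f x‖ ^ 2) (Ioi 0))
    (hφ : IsSolAt Q z 0 φ φ') (h0 : φ 0 = 0) (h1 : φ' 0 = 1) :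
    ∃ u w, IsApproximable Q z φ f u w ∧ u 0 = 0 := by
  obtain ⟨p, p', hp, hp0, -⟩ := exists_isSol hQ hf z 0 0 0
  choose c hbc hle using fun n : ℕ => exists_regular_resolvent hQ hz hf
    (intervalIntegrable_of_integrableOn_Ioi hf2 le_rfl (show (0 : ℝ) ≤ (n : ℝ) + 1 by positivity))
    hφ h0 h1 hp hp0 (show (0 : ℝ) < (n : ℝ) + 1 by positivity) 0
  simp only [Real.cos_zero, Real.sin_zero, Complex.ofReal_one, Complex.ofReal_zero, mul_one,
    mul_zero, add_zero] at hbc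
  have hz2 : 0 < z.im ^ 2 := by positivity
  set C := (∫ t in Ioi (0 : ℝ), ‖f t‖ ^ 2) / z.im ^ 2 with hCdef
  have hC : ∀ n : ℕ, ∫ t in (0 : ℝ)..((n : ℝ) + 1), ‖(p + c n • φ) t‖ ^ 2 ≤ C := fun n => by
    rw [hCdef, le_div_iff₀ hz2, mul_comm]
    refine (hle n).trans ?_
    have := integral_le_tail hf2 le_rfl (show (0 : ℝ) ≤ (n : ℝ) + 1 by positivity)
    simpa using this
  have hA := IsSol.integral_norm_sq_pos hφ (Or.inr (by simp [h1])) one_pos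
  set A := ∫ t in (0 : ℝ)..1, ‖φ t‖ ^ 2
  set P := ∫ t in (0 : ℝ)..1, ‖p t‖ ^ 2
  have hbd : ∀ n, ‖c n‖ ≤ Real.sqrt ((2 * C + 2 * P) / A) := fun n => by
    refine Real.le_sqrt_of_sq_le ?_
    rw [le_div_iff₀ hA]
    refine (integral_norm_sq_coeff_le hp.continuous hφ.continuous (c n)
      (show (1 : ℝ) ≤ (n : ℝ) + 1 by linarith [n.cast_nonneg (α := ℝ)])).trans ?_
    have := hC n
    gcongr
  obtain ⟨a, ha⟩ := exists_tendsto_hyperfilter hbd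
  exact ⟨_, _, IsApproximable.of_tendsto hQ hf hφ hp ha hbc hC, by simp [hp0, h0]⟩

/-- Existence of the Weyl solution on the half-line. -/
lemma exists_approximable_weyl (hQ : LocallyIntegrable Q) (hz : z.im ≠ 0)
    (hφ : IsSolAt Q z 0 φ φ') (h0 : φ 0 = 0) (h1 : φ' 0 = 1) :
    ∃ u w, IsApproximable Q z φ 0 u w ∧ u 0 = 1 ∧ 0 < (w 0).im / z.im := by
  obtain ⟨θ, θ', hθ, hθ0, hθ1⟩ := exists_isSol hQ locallyIntegrable_zero z 0 1 0
  choose m hbc hm using fun n : ℕ => exists_regular_weyl hQ hz hφ h0 h1 hθ hθ0 hθ1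
    (show (0 : ℝ) < (n : ℝ) + 1 by positivity) 0
  simp only [Real.cos_zero, Real.sin_zero, Complex.ofReal_one, Complex.ofReal_zero, mul_one,
    mul_zero, add_zero] at hbc
  have hI : ∀ n : ℕ, ∫ t in (0 : ℝ)..((n : ℝ) + 1), ‖(θ + m n • φ) t‖ ^ 2 = (m n).im / z.im :=
    fun n => by
      rw [hm n]
      field_simp
  have hI' : ∀ n, (m n).im / z.im ≤ ‖m n‖ / |z.im| := fun n => by
    refine (le_abs_self _).trans ?_
    rw [abs_div]
    gcongr
    exact Complex.abs_im_le_norm _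
  have hA := IsSol.integral_norm_sq_pos hφ (Or.inr (by simp [h1])) one_pos
  have hcoef : ∀ n, ‖m n‖ ^ 2 * ∫ t in (0 : ℝ)..1, ‖φ t‖ ^ 2 ≤
      2 * (‖m n‖ / |z.im|) + 2 * ∫ t in (0 : ℝ)..1, ‖θ t‖ ^ 2 := fun n => by
    refine (integral_norm_sq_coeff_le hθ.continuous hφ.continuous (m n)
      (show (1 : ℝ) ≤ (n : ℝ) + 1 by linarith [n.cast_nonneg (α := ℝ)])).trans ?_
    have := (hI n).trans_le (hI' n)
    gcongr
  have hP : 0 ≤ ∫ t in (0 : ℝ)..1, ‖θ t‖ ^ 2 :=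
    intervalIntegral.integral_nonneg zero_le_one fun t _ => by positivity
  set A := ∫ t in (0 : ℝ)..1, ‖φ t‖ ^ 2
  set P := ∫ t in (0 : ℝ)..1, ‖θ t‖ ^ 2
  have hy : 0 < |z.im| := abs_pos.2 hz
  -- The norm of the approximant is itself controlled by `m n`, but only linearly, against the
  -- square on the left of `hcoef`. When `‖m n‖ ≥ 1`, one factor is divided out.
  have hbd : ∀ n, ‖m n‖ ≤ 1 + (2 / |z.im| + 2 * P) / A := fun n => by
    have hR : 0 ≤ (2 / |z.im| + 2 * P) / A := by positivity
    rcases le_total ‖m n‖ 1 with h | h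
    · linarith
    · have h2 : ‖m n‖ * ‖m n‖ * A ≤ (2 / |z.im| + 2 * P) * ‖m n‖ := by
        have h3 := hcoef n
        have h4 : 2 * (‖m n‖ / |z.im|) = 2 / |z.im| * ‖m n‖ := by ring
        nlinarith
      have h5 : ‖m n‖ * A ≤ 2 / |z.im| + 2 * P := by
        refine le_of_mul_le_mul_right ?_ (lt_of_lt_of_le one_pos h)
        linarith
      have := (le_div_iff₀ hA).2 h5
      linarith
  obtain ⟨a, ha⟩ := exists_tendsto_hyperfilter hbd
  have happ : IsApproximable Q z φ 0 (θ + a • φ) (θ' + a • φ') :=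
    IsApproximable.of_tendsto (C := (1 + (2 / |z.im| + 2 * P) / A) / |z.im|) hQ
      locallyIntegrable_zero hφ hθ ha hbc fun n => by
      rw [hI n]
      refine (hI' n).trans ?_
      have := hbd n
      gcongr
  refine ⟨_, _, happ, by simp [hθ0, h0], ?_⟩
  have hpos := IsSol.integral_norm_sq_pos happ.isSolAt (Or.inl (by simp [hθ0, h0])) one_pos
  have hw : (θ' + a • φ') 0 = a := by simp [hθ1, h1]
  rw [hw]
  -- Strict positivity could be lost in the limit. It survives because these quantities all dominate
  -- the fixed positive number `∫ ‖θ + a φ‖²` over `[0, 1]`.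
  have hlim : Tendsto (fun n => 2 * ((m n).im / z.im) + 2 * (‖a - m n‖ ^ 2 * A))
      (hyperfilter ℕ : Filter ℕ) (𝓝 (2 * (a.im / z.im) + 2 * (‖a - a‖ ^ 2 * A))) :=
    ((((Complex.continuous_im.tendsto a).comp ha).div_const _).const_mul 2).add
      ((((ha.const_sub a).norm.pow 2).mul_const A).const_mul 2)
  have hge := ge_of_tendsto' (b := ∫ t in (0 : ℝ)..1, ‖(θ + a • φ) t‖ ^ 2) hlim fun n => ?_
  · simp only [sub_self, norm_zero, ne_eq, OfNat.ofNat_ne_zero, not_false_eq_true, zero_pow,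
      zero_mul, mul_zero, add_zero] at hge
    linarith
  · have e : θ + a • φ = (θ + m n • φ) + (a - m n) • φ := by
      rw [sub_smul]
      abel
    have hcθ := hθ.continuous
    have hcφ := hφ.continuous
    conv_lhs => rw [e]
    refine (integral_norm_sq_add_le (by fun_prop) (by fun_prop) zero_le_one).trans ?_
    rw [integral_norm_sq_smul, ← hI n]
    have := integral_norm_sq_mono (u := θ + m n • φ) (by fun_prop) le_rfl zero_le_one
      (show (1 : ℝ) ≤ (n : ℝ) + 1 by linarith [n.cast_nonneg (α := ℝ)])
    gcongr

/-- In the limit point case, every square integrable solution is approximable. -/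
lemma isApproximable_of_memLp {V : ℝ → ℝ} (hLP : IsLimitPointAtInfinity V)
    (hQV : ∀ x ∈ Ioi (0 : ℝ), Q x = V x) (hQ : LocallyIntegrable Q) (hz : z.im ≠ 0)
    (hf : LocallyIntegrable f) (hf2 : IntegrableOn (fun x => ‖f x‖ ^ 2) (Ioi 0))
    (hφ : IsSolAt Q z 0 φ φ') (h0 : φ 0 = 0) (h1 : φ' 0 = 1)
    (hu : IsSolAt Q z f u w) (hu2 : MemLp u 2 (volume.restrict (Ioi 0))) :
    IsApproximable Q z φ f u w := by
  obtain ⟨r, r', hr, -⟩ := exists_approximable_resolvent hQ hz hf hf2 hφ h0 h1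
  obtain ⟨ψ, ψ', hψ, hψ0, -⟩ := exists_approximable_weyl hQ hz hφ h0 h1
  set s := u + (-1 : ℂ) • r with hs
  set s' := w + (-1 : ℂ) • r' with hs'
  have hsol : IsSolAt Q z 0 s s' := by
    have := hu.add hQ hf (g := (-1 : ℂ) • f) (by simpa using hf.neg) (hr.isSolAt.const_smul (-1))
    simpa [hs, hs'] using this
  have hs2 : MemLp s 2 (volume.restrict (Ioi 0)) := hu2.add ((hr.memLp hφ).const_smul _)
  have hψ2 := hψ.memLp hφ
  have hsolκ := hsol.add_smul hQ locallyIntegrable_zero hψ.isSolAt (-s 0)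
  set κ := (s' + (-s 0) • ψ') 0 with hκ
  have eκ : s + (-s 0) • ψ = κ • φ := by
    have h2 : IsSolAt Q z 0 (κ • φ) (κ • φ') := by simpa using hφ.const_smul κ
    exact (hsolκ.unique hQ locallyIntegrable_zero h2 (by simp [h0, hψ0]) (by simp [h1, hκ])).1
  -- If `κ ≠ 0`, then `φ` is square integrable along with `ψ`. These two span the homogeneous
  -- solutions, which is the limit circle case at `z`.
  have hκ0 : κ = 0 := by
    by_contra hne
    have hφ2 : MemLp φ 2 (volume.restrict (Ioi 0)) := by
      have e : φ = κ⁻¹ • (s + (-s 0) • ψ) := by rw [eκ, smul_smul, inv_mul_cancel₀ hne, one_smul]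
      rw [e]
      exact (hs2.add (hψ2.const_smul _)).const_smul _
    refine hLP ⟨z, fun g g' hg => ⟨1, one_pos, ?_⟩⟩
    obtain ⟨G, G', hG, hGg⟩ := hg.exists_isSol ordConnected_Ioi measurableSet_Ioi (z := z) hQ
      (locallyIntegrable_zero : LocallyIntegrable (0 : ℝ → ℂ)) hQV
      (Eventually.of_forall fun x => by simp)
    have hG : IsSolAt Q z 0 G G' := hG
    have hGe : G = G 0 • ψ + (G' 0 - G 0 * ψ' 0) • φ := by
      have h2 := (hψ.isSolAt.const_smul (G 0)).add_smul hQ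
        (by rw [smul_zero]; exact locallyIntegrable_zero) hφ (G' 0 - G 0 * ψ' 0)
      rw [smul_zero] at h2
      exact (IsSolAt.unique hQ locallyIntegrable_zero hG h2 (by simp [h0, hψ0])
        (by simp [h1])).1
    have hG2 : MemLp G 2 (volume.restrict (Ioi 0)) := by
      rw [hGe]
      exact (hψ2.const_smul _).add (hφ2.const_smul _)
    have hG3 : MemLp G 2 (volume.restrict (Ioi 1)) :=
      hG2.mono_measure (Measure.restrict_mono (Ioi_subset_Ioi zero_le_one) le_rfl)
    refine hG3.ae_eq ?_
    filter_upwards [ae_restrict_mem measurableSet_Ioi] with x hx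
    exact (hGg x (mem_Ioi.2 (one_pos.trans hx))).1.symm
  have hfin := hr.add_smul hQ hf hφ hψ (s 0)
  have e0 : s = s 0 • ψ := by
    have : s + (-s 0) • ψ = 0 := by rw [eκ, hκ0, zero_smul]
    rw [neg_smul] at this
    exact add_neg_eq_zero.1 this
  have e1 : s' = s 0 • ψ' := by
    have h2 : IsSolAt Q z 0 (s 0 • ψ) (s 0 • ψ') := by simpa using hψ.isSolAt.const_smul (s 0)
    refine (hsol.unique hQ locallyIntegrable_zero h2 (by simp [hψ0]) ?_).2
    have := hκ0
    simp only [hκ, Pi.add_apply, Pi.smul_apply, smul_eq_mul, neg_mul] at this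
    simpa using add_neg_eq_zero.1 this
  have eu : r + s 0 • ψ = u := by
    rw [← e0, hs, neg_one_smul]
    abel
  have ew : r' + s 0 • ψ' = w := by
    rw [← e1, hs', neg_one_smul]
    abel
  rwa [eu, ew] at hfin

end HalfLine

/-! ### The operator on a single link -/

lemma link_cases {ℓ : EReal} (hℓ : 0 < ℓ) :
    (ℓ = ⊤ ∧ link ℓ = Ioi 0) ∨ ∃ L : ℝ, 0 < L ∧ ℓ = (L : EReal) ∧ link ℓ = Ioo 0 L := by
  induction ℓ with
  | bot => simp at hℓ
  | top => exact Or.inl ⟨rfl, by ext x; simp [link]⟩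
  | coe L => exact Or.inr ⟨L, by exact_mod_cast hℓ, rfl, by ext x; simp [link]⟩

lemma ordConnected_link (ℓ : EReal) : (link ℓ).OrdConnected :=
  ⟨fun _ hx _ hy _ hz => ⟨hx.1.trans_le hz.1,
    lt_of_le_of_lt (EReal.coe_le_coe_iff.2 hz.2) hy.2⟩⟩

lemma link_mem_nhdsGT {ℓ : EReal} (hℓ : 0 < ℓ) : link ℓ ∈ 𝓝[>] (0 : ℝ) := by
  rcases link_cases hℓ with ⟨-, h⟩ | ⟨L, hL, -, h⟩
  · rw [h]
    exact self_mem_nhdsWithin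
  · rw [h]
    exact Ioo_mem_nhdsGT hL

lemma link_mem_nhdsLT {L : ℝ} (hL : 0 < (L : EReal)) : link L ∈ 𝓝[<] L := by
  have h : link L = Ioo 0 L := by ext x; simp [link]
  rw [h]
  exact Ioo_mem_nhdsLT (by exact_mod_cast hL)

lemma isClosed_closedLink (ℓ : EReal) : IsClosed (closedLink ℓ) :=
  (isClosed_le continuous_const continuous_id).inter
    (isClosed_le continuous_coe_real_ereal continuous_const)

/-- The potential, extended by zero, is locally integrable on the real line. -/
lemma locallyIntegrable_indicator_link {ℓ : EReal} {V : ℝ → ℝ}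
    (hV : LocallyIntegrableOn V (closedLink ℓ)) : LocallyIntegrable ((link ℓ).indicator V) := by
  rw [locallyIntegrable_iff]
  intro K hK
  have h1 : IntegrableOn V (closedLink ℓ ∩ K) := hV.integrableOn_compact_subset
    inter_subset_left (hK.inter_left (isClosed_closedLink ℓ))
  have hI := (isOpen_link ℓ).measurableSet
  rw [IntegrableOn, integrable_indicator_iff hI, IntegrableOn, Measure.restrict_restrict hI]
  exact h1.mono_set (inter_subset_inter_left _ fun x hx => ⟨hx.1.le, hx.2.le⟩)

lemma locallyIntegrable_indicator_of_memLp {I : Set ℝ} (hI : MeasurableSet I) {f : ℝ → ℂ}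
    (hf : MemLp f 2 (volume.restrict I)) : LocallyIntegrable (I.indicator f) :=
  ((memLp_indicator_iff_restrict hI).2 hf).locallyIntegrable (by norm_num)

lemma memLp_Ioo_of_continuous {u : ℝ → ℂ} (hu : Continuous u) (L : ℝ) :
    MemLp u 2 (volume.restrict (Ioo 0 L)) := by
  rw [memLp_two_iff_integrable_sq_norm hu.aestronglyMeasurable]
  exact (Continuous.integrableOn_Icc (by fun_prop)).mono_set Ioo_subset_Icc_self

lemma integrableOn_norm_sq {I : Set ℝ} {f : ℝ → ℂ} (hf : MemLp f 2 (volume.restrict I)) :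
    IntegrableOn (fun x => ‖f x‖ ^ 2) I :=
  (memLp_two_iff_integrable_sq_norm hf.1).1 hf

/-- The boundary condition at the end of a link of finite length. -/
def EndValue (ℓ : EReal) (ω : ℝ) (u w : ℝ → ℂ) : Prop :=
  ∀ L : ℝ, ℓ = (L : EReal) → u L * (Real.cos ω : ℂ) + w L * (Real.sin ω : ℂ) = 0

lemma EndValue.add_smul {ℓ : EReal} {ω : ℝ} {u w v y : ℝ → ℂ} (h : EndValue ℓ ω u w)
    (h' : EndValue ℓ ω v y) (c : ℂ) : EndValue ℓ ω (u + c • v) (w + c • y) := fun L hL => by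
  simp only [Pi.add_apply, Pi.smul_apply, smul_eq_mul]
  linear_combination h L hL + c * h' L hL

section Link

variable {ℓ : EReal} {V Q : ℝ → ℝ} {z : ℂ} {f F G u w v y : ℝ → ℂ}

/-- The Weyl solution on a link. -/
lemma exists_link_weyl (hℓ : 0 < ℓ) (hQ : LocallyIntegrable Q) (hz : z.im ≠ 0) (ω : ℝ) :
    ∃ u w, IsSolAt Q z 0 u w ∧ MemLp u 2 (volume.restrict (link ℓ)) ∧ EndValue ℓ ω u w ∧
      u 0 = 1 ∧ 0 < (w 0).im / z.im := by
  obtain ⟨φ, φ', hφ, h0, h1⟩ := exists_isSol hQ locallyIntegrable_zero z 0 0 1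
  rcases link_cases hℓ with ⟨rfl, h⟩ | ⟨L, hL, rfl, h⟩
  · obtain ⟨u, w, hu, hu0, hw0⟩ := exists_approximable_weyl hQ hz hφ h0 h1
    exact ⟨u, w, hu.isSolAt, h ▸ hu.memLp hφ, fun L hL => absurd hL (by simp), hu0, hw0⟩
  · obtain ⟨θ, θ', hθ, hθ0, hθ1⟩ := exists_isSol hQ locallyIntegrable_zero z 0 1 0
    obtain ⟨m, hbc, hm⟩ := exists_regular_weyl hQ hz hφ h0 h1 hθ hθ0 hθ1 hL ω
    have hs := IsSolAt.add_smul hQ locallyIntegrable_zero hθ hφ m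
    refine ⟨_, _, hs, h ▸ memLp_Ioo_of_continuous hs.continuous L, fun L' hL' => ?_,
      by simp [hθ0, h0], ?_⟩
    · rw [← EReal.coe_eq_coe_iff.1 hL']
      exact hbc
    · have hpos := IsSol.integral_norm_sq_pos hs (Or.inl (by simp [hθ0, h0])) hL
      have e : (θ' + m • φ') 0 = m := by simp [hθ1, h1]
      rw [e, hm, mul_div_cancel_left₀ _ hz]
      exact hpos

/-- Solvability of the resolvent equation on a link, with a Dirichlet condition at `0`. -/
lemma exists_link_resolvent (hℓ : 0 < ℓ) (hQ : LocallyIntegrable Q) (hz : z.im ≠ 0) (ω : ℝ)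
    (hf : LocallyIntegrable f) (hf2 : MemLp f 2 (volume.restrict (link ℓ))) :
    ∃ u w, IsSolAt Q z f u w ∧ MemLp u 2 (volume.restrict (link ℓ)) ∧ EndValue ℓ ω u w ∧
      u 0 = 0 := by
  obtain ⟨φ, φ', hφ, h0, h1⟩ := exists_isSol hQ locallyIntegrable_zero z 0 0 1
  rcases link_cases hℓ with ⟨rfl, h⟩ | ⟨L, hL, rfl, h⟩
  · rw [h] at hf2 ⊢
    obtain ⟨u, w, hu, hu0⟩ :=
      exists_approximable_resolvent hQ hz hf (integrableOn_norm_sq hf2) hφ h0 h1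
    exact ⟨u, w, hu.isSolAt, hu.memLp hφ, fun L hL => absurd hL (by simp), hu0⟩
  · obtain ⟨p, p', hp, hp0, -⟩ := exists_isSol hQ hf z 0 0 0
    obtain ⟨m, hbc⟩ := exists_boundary_coeff hQ hz hφ h0 h1 p p' hL ω
    have hs := IsSolAt.add_smul hQ hf hp hφ m
    refine ⟨_, _, hs, h ▸ memLp_Ioo_of_continuous hs.continuous L, fun L' hL' => ?_,
      by simp [hp0, h0]⟩
    rw [← EReal.coe_eq_coe_iff.1 hL']
    exact hbc

/-- In the limit point case, the Wronskian of two elements of the maximal domain vanishes at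
infinity. -/
lemma tendsto_wronskian_of_limitPoint (hLP : IsLimitPointAtInfinity V)
    (hQV : ∀ x ∈ Ioi (0 : ℝ), Q x = V x) (hQ : LocallyIntegrable Q)
    (hF : LocallyIntegrable F) (hG : LocallyIntegrable G)
    (hF2 : MemLp F 2 (volume.restrict (Ioi 0))) (hG2 : MemLp G 2 (volume.restrict (Ioi 0)))
    (hu2 : MemLp u 2 (volume.restrict (Ioi 0))) (hv2 : MemLp v 2 (volume.restrict (Ioi 0)))
    (h : IsSol Q F u w) (h' : IsSol Q G v y) :
    Tendsto (fun x => u x * y x - w x * v x) atTop (𝓝 0) := by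
  have hz : Complex.I.im ≠ 0 := by simp
  obtain ⟨φ, φ', hφ, h0, h1⟩ := exists_isSol hQ locallyIntegrable_zero Complex.I 0 0 1
  -- Writing `F = i u + (F - i u)` turns an element of the maximal domain into a solution at the
  -- spectral parameter `i` with square integrable source. Any common nonreal parameter would do.
  have key : ∀ {F u w : ℝ → ℂ}, LocallyIntegrable F → MemLp F 2 (volume.restrict (Ioi 0)) →
      MemLp u 2 (volume.restrict (Ioi 0)) → IsSol Q F u w →
      LocallyIntegrable (F - Complex.I • u) ∧
      IntegrableOn (fun x => ‖(F - Complex.I • u) x‖ ^ 2) (Ioi 0) ∧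
      IsApproximable Q Complex.I φ (F - Complex.I • u) u w := by
    intro F u w hF hF2 hu2 h
    have hf : LocallyIntegrable (F - Complex.I • u) :=
      hF.sub (h.continuous.const_smul Complex.I).locallyIntegrable
    have hf2 := integrableOn_norm_sq (hF2.sub (hu2.const_smul Complex.I))
    refine ⟨hf, hf2, isApproximable_of_memLp hLP hQV hQ hz hf hf2 hφ h0 h1 ?_ hu2⟩
    exact h.congr fun x => by simp
  obtain ⟨a1, a2, a3⟩ := key hF hF2 hu2 h
  obtain ⟨b1, b2, b3⟩ := key hG hG2 hv2 h'
  exact a3.tendsto_wronskian hQ a1 b1 a2 b2 hφ b3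

/-- Green's identity on a link. -/
lemma integral_link_green (hℓ : 0 < ℓ) (hLP : ℓ = ⊤ → IsLimitPointAtInfinity V)
    (hQV : ∀ x ∈ link ℓ, Q x = V x) (hQ : LocallyIntegrable Q) {ω : ℝ}
    (hF : LocallyIntegrable F) (hG : LocallyIntegrable G)
    (hF2 : MemLp F 2 (volume.restrict (link ℓ))) (hG2 : MemLp G 2 (volume.restrict (link ℓ)))
    (hu2 : MemLp u 2 (volume.restrict (link ℓ))) (hv2 : MemLp v 2 (volume.restrict (link ℓ)))
    (h : IsSol Q F u w) (h' : IsSol Q G v y) (hu : EndValue ℓ ω u w) (hv : EndValue ℓ ω v y) :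
    ∫ x in link ℓ, (F x * (starRingEnd ℂ) (v x) - u x * (starRingEnd ℂ) (G x)) =
      -(u 0 * (starRingEnd ℂ) (y 0) - w 0 * (starRingEnd ℂ) (v 0)) := by
  have hGc : LocallyIntegrable fun x => (starRingEnd ℂ) (G x) :=
    locallyIntegrable_of_intervalIntegrable fun a b => by
      have := intervalIntegrable_of_locallyIntegrable hG a b
      rw [intervalIntegrable_iff] at this ⊢
      exact (Complex.conjCLE.toContinuousLinearMap).integrable_comp this
  have hlag := fun b => IsSol.integral_lagrange hQ hF hGc h h'.conj 0 b
  rcases link_cases hℓ with ⟨rfl, hI⟩ | ⟨L, hL, rfl, hI⟩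
  · rw [hI] at hF2 hG2 hu2 hv2 hQV ⊢
    have hGc2 : MemLp (fun x => (starRingEnd ℂ) (G x)) 2 (volume.restrict (Ioi 0)) := hG2.star
    have hvc2 : MemLp (fun x => (starRingEnd ℂ) (v x)) 2 (volume.restrict (Ioi 0)) := hv2.star
    have h_integrable : IntegrableOn (fun x => F x * (starRingEnd ℂ) (v x) -
        u x * (starRingEnd ℂ) (G x)) (Ioi 0) :=
      (hF2.integrable_mul hvc2).sub (hu2.integrable_mul hGc2)
    have h1 := intervalIntegral_tendsto_integral_Ioi 0 h_integrable tendsto_id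
    have h2 := (tendsto_wronskian_of_limitPoint (hLP rfl) hQV hQ hF hGc hF2 hGc2 hu2 hvc2 h
      h'.conj).sub_const (u 0 * (starRingEnd ℂ) (y 0) - w 0 * (starRingEnd ℂ) (v 0))
    rw [zero_sub] at h2
    refine tendsto_nhds_unique h1 (h2.congr fun b => ?_)
    exact (hlag b).symm
  · rw [hI, ← integral_Ioc_eq_integral_Ioo, ← intervalIntegral.integral_of_le hL.le, hlag L,
      wronskian_eq_zero_of_boundary (hu L rfl) (conj_boundary (hv L rfl)), zero_sub]

end Link

/-! ### A criterion for self-adjointness -/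

section Criterion

variable {E : Type*} [NormedAddCommGroup E] [InnerProductSpace ℂ E] [CompleteSpace E]

/-- A symmetric operator `A` such that `A - i` and `A + i` are onto is self-adjoint. -/
theorem isSelfAdjoint_of_surjective {A : E →ₗ.[ℂ] E}
    (hsymm : ∀ p ∈ A.graph, ∀ q ∈ A.graph, inner ℂ p.2 q.1 = inner ℂ p.1 q.2)
    (hsurj : ∀ z : ℂ, z.im ≠ 0 → ∀ f : E, ∃ p ∈ A.graph, p.2 = z • p.1 + f) :
    IsSelfAdjoint A := by
  have key : ∀ x y : E, (∀ q ∈ A.graph, inner ℂ q.2 x = inner ℂ q.1 y) → (x, y) ∈ A.graph := by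
    intro x y hxy
    -- With `(A - i) p = y - i x`, the vector `x - p` is formally in the kernel of the adjoint minus
    -- `i`, hence orthogonal to the range of `A + i`. It lies in that range, as witnessed by `q`, so
    -- it is zero.
    obtain ⟨p, hp, hp2⟩ := hsurj Complex.I (by simp) (y - Complex.I • x)
    obtain ⟨q, hq, hq2⟩ := hsurj (-Complex.I) (by simp) (x - p.1)
    have h1 := hxy q hq
    have h2 := hsymm q hq p hp
    have h3 : inner ℂ (x - p.1) (x - p.1) = (0 : ℂ) := by
      have e : x - p.1 = q.2 + Complex.I • q.1 := by
        rw [hq2, neg_smul]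
        abel
      have e2 : inner ℂ q.1 (y - p.2) = Complex.I * inner ℂ q.1 (x - p.1) := by
        rw [← inner_smul_right]
        congr 1
        rw [hp2, smul_sub]
        abel
      calc inner ℂ (x - p.1) (x - p.1) = inner ℂ (q.2 + Complex.I • q.1) (x - p.1) := by rw [← e]
        _ = (inner ℂ q.2 x - inner ℂ q.2 p.1) - Complex.I * inner ℂ q.1 (x - p.1) := by
          rw [inner_add_left, inner_smul_left, inner_sub_right q.2, Complex.conj_I]
          ring
        _ = 0 := by rw [h1, h2, ← inner_sub_right, e2, sub_self]
    have hx : x = p.1 := sub_eq_zero.1 (inner_self_eq_zero.1 h3)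
    have hy : y = p.2 := by
      rw [hp2, ← hx]
      abel
    rw [hx, hy]
    exact hp
  -- For `x` orthogonal to the domain, `(0, x)` is a formal adjoint pair. By `key`, which needs no
  -- density, it lies in the graph, so `x = 0`.
  have hdense : Dense (A.domain : Set E) := by
    rw [Submodule.dense_iff_topologicalClosure_eq_top, Submodule.topologicalClosure_eq_top_iff,
      Submodule.eq_bot_iff]
    intro x hx
    have h0 := key 0 x fun q hq => by
      rw [inner_zero_right, (Submodule.mem_orthogonal _ _).1 hx q.1 (A.mem_domain_of_mem_graph hq)]
    exact A.graph_fst_eq_zero_snd h0 rfl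
  rw [LinearPMap.isSelfAdjoint_def]
  refine LinearPMap.eq_of_eq_graph ?_
  rw [LinearPMap.adjoint_graph_eq_graph_adjoint hdense]
  ext ⟨x, y⟩
  rw [Submodule.mem_adjoint_iff]
  constructor
  · exact fun h => key x y fun q hq => sub_eq_zero.1 (h q.1 q.2 hq)
  · exact fun h a b hab => sub_eq_zero.2 (hsymm (a, b) hab (x, y) h)

end Criterion

/-! ### The star graph -/

section Star

variable {N : ℕ} {ℓ : Fin N → EReal} {V : Fin N → ℝ → ℝ} {ω : Fin N → ℝ} {α : OnePoint ℝ}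

/-- The vertex condition for functions which are continuous up to the vertex. -/
def VertexValue (α : OnePoint ℝ) (u w : Fin N → ℝ → ℂ) : Prop :=
  (∀ a : ℝ, α = (a : OnePoint ℝ) →
    ∃ c : ℂ, (∀ j, u j 0 = c) ∧ ∑ j, w j 0 = (a : ℂ) * c) ∧
  (α = OnePoint.infty → ∀ j, u j 0 = 0)

/-- Elements of the graph have representatives which solve the equation on the real line, with
potentials extended by zero. -/
lemma exists_of_mem_hamiltonianGraph (hℓ : ∀ j, 0 < ℓ j)
    (hV : ∀ j, LocallyIntegrableOn (V j) (closedLink (ℓ j))) {p : StateSpace ℓ × StateSpace ℓ}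
    (hp : p ∈ hamiltonianGraph ℓ V ω α) :
    ∃ F u w : Fin N → ℝ → ℂ, (∀ j, LocallyIntegrable (F j)) ∧
      (∀ j, (p.1 j : ℝ → ℂ) =ᵐ[volume.restrict (link (ℓ j))] u j) ∧
      (∀ j, (p.2 j : ℝ → ℂ) =ᵐ[volume.restrict (link (ℓ j))] F j) ∧
      (∀ j, IsSol ((link (ℓ j)).indicator (V j)) (F j) (u j) (w j)) ∧
      VertexValue α u w ∧ ∀ j, EndValue (ℓ j) (ω j) (u j) (w j) := by
  obtain ⟨u, w, h1, h2, h3, h4⟩ := hp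
  have hm := fun j => (isOpen_link (ℓ j)).measurableSet
  have hF : ∀ j, LocallyIntegrable ((link (ℓ j)).indicator (p.2 j : ℝ → ℂ)) := fun j =>
    locallyIntegrable_indicator_of_memLp (hm j) (Lp.memLp (p.2 j))
  have hFe : ∀ j, (p.2 j : ℝ → ℂ) =ᵐ[volume.restrict (link (ℓ j))]
      (link (ℓ j)).indicator (p.2 j : ℝ → ℂ) := fun j => (indicator_ae_eq_restrict (hm j)).symm
  choose U W hU hUu using fun j => (h2 j).exists_isSol (ordConnected_link _) (hm j) (z := 0)
    (locallyIntegrable_indicator_link (hV j)) (hF j)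
    (fun x hx => indicator_of_mem hx _) (by
      filter_upwards [hFe j] with x hx
      rw [zero_mul, zero_add, ← hx])
  have hUs : ∀ j, IsSol ((link (ℓ j)).indicator (V j)) ((link (ℓ j)).indicator (p.2 j : ℝ → ℂ))
      (U j) (W j) := fun j => (hU j).congr fun x => by rw [zero_mul, zero_add]
  have value : ∀ {j : Fin N} {g h : ℝ → ℂ} {x : ℝ} {l : Filter ℝ} [l.NeBot] {c : ℂ},
      Continuous h → l ≤ 𝓝 x → link (ℓ j) ∈ l → (∀ t ∈ link (ℓ j), g t = h t) →
      Tendsto g l (𝓝 c) → h x = c := by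
    intro j g h x l _ c hc hl hlink hgh hg
    refine tendsto_nhds_unique ((hc.tendsto x).mono_left hl) (hg.congr' ?_)
    filter_upwards [hlink] with t ht using hgh t ht
  refine ⟨_, U, W, hF, fun j => ?_, hFe, hUs, ⟨fun a ha => ?_, fun ha j => ?_⟩, fun j L hL => ?_⟩
  · refine (h1 j).trans ?_
    filter_upwards [ae_restrict_mem (hm j)] with x hx using (hUu j x hx).1
  · obtain ⟨c, d, hc, hd, he⟩ := h3.1 a ha
    refine ⟨c, fun j => ?_, ?_⟩
    · exact value (hUs j).continuous nhdsWithin_le_nhds (link_mem_nhdsGT (hℓ j))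
        (fun t ht => (hUu j t ht).1) (hc j)
    · rw [← he]
      exact Finset.sum_congr rfl fun j _ => value (hUs j).continuous_deriv nhdsWithin_le_nhds
        (link_mem_nhdsGT (hℓ j)) (fun t ht => (hUu j t ht).2) (hd j)
  · exact value (hUs j).continuous nhdsWithin_le_nhds (link_mem_nhdsGT (hℓ j))
      (fun t ht => (hUu j t ht).1) (h3.2 ha j)
  · obtain ⟨c, d, hc, hd, he⟩ := h4 j L hL
    have hlk : link (ℓ j) ∈ 𝓝[<] L := by
      have := hℓ j
      rw [hL] at this ⊢
      exact link_mem_nhdsLT this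
    rw [value (hUs j).continuous nhdsWithin_le_nhds hlk (fun t ht => (hUu j t ht).1) hc,
      value (hUs j).continuous_deriv nhdsWithin_le_nhds hlk (fun t ht => (hUu j t ht).2) hd]
    exact he

/-- Solutions on the real line satisfying the boundary conditions give elements of the graph. -/
lemma mem_hamiltonianGraph_of_isSol
    (hV : ∀ j, LocallyIntegrableOn (V j) (closedLink (ℓ j))) {p : StateSpace ℓ × StateSpace ℓ}
    {F u w : Fin N → ℝ → ℂ} (hF : ∀ j, LocallyIntegrable (F j))
    (h1 : ∀ j, (p.1 j : ℝ → ℂ) =ᵐ[volume.restrict (link (ℓ j))] u j)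
    (h2 : ∀ j, (p.2 j : ℝ → ℂ) =ᵐ[volume.restrict (link (ℓ j))] F j)
    (h3 : ∀ j, IsSol ((link (ℓ j)).indicator (V j)) (F j) (u j) (w j))
    (h4 : VertexValue α u w) (h5 : ∀ j, EndValue (ℓ j) (ω j) (u j) (w j)) :
    p ∈ hamiltonianGraph ℓ V ω α := by
  have hu : ∀ j x, Tendsto (u j) (𝓝 x) (𝓝 (u j x)) := fun j x => (h3 j).continuous.tendsto x
  have hw : ∀ j x, Tendsto (w j) (𝓝 x) (𝓝 (w j x)) := fun j x =>
    (h3 j).continuous_deriv.tendsto x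
  refine ⟨u, w, h1, fun j => ?_, ⟨fun a ha => ?_, fun ha j => ?_⟩, fun j L hL => ?_⟩
  · exact (IsSol.solvesOn (isOpen_link _).measurableSet (locallyIntegrable_indicator_link (hV j))
      (hF j) (fun x hx => indicator_of_mem hx _) (h3 j)).congr (h2 j)
  · obtain ⟨c, hc, hd⟩ := h4.1 a ha
    exact ⟨c, fun j => w j 0, fun j => hc j ▸ (hu j 0).mono_left nhdsWithin_le_nhds,
      fun j => (hw j 0).mono_left nhdsWithin_le_nhds, hd⟩
  · exact h4.2 ha j ▸ (hu j 0).mono_left nhdsWithin_le_nhds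
  · exact ⟨u j L, w j L, (hu j L).mono_left nhdsWithin_le_nhds,
      (hw j L).mono_left nhdsWithin_le_nhds, h5 j L hL⟩

/-- The boundary form at the vertex vanishes. -/
lemma sum_vertex_eq_zero {u w v y : Fin N → ℝ → ℂ} (h : VertexValue α u w)
    (h' : VertexValue α v y) :
    ∑ j, (u j 0 * (starRingEnd ℂ) (y j 0) - w j 0 * (starRingEnd ℂ) (v j 0)) = 0 := by
  induction α using OnePoint.rec with
  | infty =>
    refine Finset.sum_eq_zero fun j _ => ?_
    rw [h.2 rfl j, h'.2 rfl j, zero_mul, map_zero, mul_zero, sub_zero]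
  | coe a =>
    obtain ⟨c, hc, hd⟩ := h.1 a rfl
    obtain ⟨c', hc', hd'⟩ := h'.1 a rfl
    simp only [hc, hc', Finset.sum_sub_distrib]
    rw [← Finset.mul_sum, ← Finset.sum_mul, ← map_sum, hd, hd', map_mul, Complex.conj_ofReal]
    ring

/-- The operator `H_α(V)` is symmetric. -/
lemma hamiltonianGraph_symmetric (hℓ : ∀ j, 0 < ℓ j)
    (hV : ∀ j, LocallyIntegrableOn (V j) (closedLink (ℓ j)))
    (hLP : ∀ j, ℓ j = ⊤ → IsLimitPointAtInfinity (V j)) {p q : StateSpace ℓ × StateSpace ℓ}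
    (hp : p ∈ hamiltonianGraph ℓ V ω α) (hq : q ∈ hamiltonianGraph ℓ V ω α) :
    inner ℂ p.2 q.1 = inner ℂ p.1 q.2 := by
  obtain ⟨G, v, y, hG, hv1, hG1, hv, hvv, hve⟩ := exists_of_mem_hamiltonianGraph hℓ hV hp
  obtain ⟨F, u, w, hF, hu1, hF1, hu, huv, hue⟩ := exists_of_mem_hamiltonianGraph hℓ hV hq
  -- The inner product is conjugate linear in its first argument, so the functions coming from `p`
  -- take the conjugated places.
  have green := fun j => integral_link_green (hℓ j) (hLP j) (fun x hx => indicator_of_mem hx _)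
    (locallyIntegrable_indicator_link (hV j)) (hF j) (hG j)
    ((Lp.memLp (q.2 j)).ae_eq (hF1 j)) ((Lp.memLp (p.2 j)).ae_eq (hG1 j))
    ((Lp.memLp (q.1 j)).ae_eq (hu1 j)) ((Lp.memLp (p.1 j)).ae_eq (hv1 j)) (hu j) (hv j)
    (hue j) (hve j)
  have key : ∀ j, inner ℂ (p.1 j) (q.2 j) - inner ℂ (p.2 j) (q.1 j) =
      -(u j 0 * (starRingEnd ℂ) (y j 0) - w j 0 * (starRingEnd ℂ) (v j 0)) := by
    intro j
    rw [← green j, L2.inner_def, L2.inner_def, ← integral_sub (L2.integrable_inner _ _)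
      (L2.integrable_inner _ _)]
    refine integral_congr_ae ?_
    filter_upwards [hv1 j, hG1 j, hu1 j, hF1 j] with x e1 e2 e3 e4
    rw [e1, e2, e3, e4]
    simp only [RCLike.inner_apply]
  rw [PiLp.inner_apply, PiLp.inner_apply, eq_comm, ← sub_eq_zero, ← Finset.sum_sub_distrib]
  simp only [key]
  rw [Finset.sum_neg_distrib, sum_vertex_eq_zero huv hvv, neg_zero]

/-- The operator `H_α(V) - z` is onto, for every nonreal `z`. -/
lemma hamiltonianGraph_surjective (hN : 0 < N) (hℓ : ∀ j, 0 < ℓ j)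
    (hV : ∀ j, LocallyIntegrableOn (V j) (closedLink (ℓ j))) {z : ℂ} (hz : z.im ≠ 0)
    (f : StateSpace ℓ) : ∃ p ∈ hamiltonianGraph ℓ V ω α, p.2 = z • p.1 + f := by
  have hm := fun j => (isOpen_link (ℓ j)).measurableSet
  have hQ := fun j => locallyIntegrable_indicator_link (hV j)
  set g : Fin N → ℝ → ℂ := fun j => (link (ℓ j)).indicator (f j : ℝ → ℂ) with hgdef
  have hg : ∀ j, LocallyIntegrable (g j) := fun j =>
    locallyIntegrable_indicator_of_memLp (hm j) (Lp.memLp (f j))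
  have hge : ∀ j, g j =ᵐ[volume.restrict (link (ℓ j))] (f j : ℝ → ℂ) := fun j =>
    indicator_ae_eq_restrict (hm j)
  choose r r' hr hr2 hre hr0 using fun j => exists_link_resolvent (hℓ j) (hQ j) hz (ω j) (hg j)
    ((Lp.memLp (f j)).ae_eq (hge j).symm)
  choose ψ ψ' hψ hψ2 hψe hψ0 hψm using fun j => exists_link_weyl (hℓ j) (hQ j) hz (ω j)
  -- As `r j 0 = 0` and `ψ j 0 = 1`, the value at the vertex is `k` on every link. Continuity is
  -- automatic, and the derivative condition reads `∑ r' j 0 = k (a - ∑ ψ' j 0)`; the Dirichlet case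
  -- takes `k = 0`.
  obtain ⟨k, hk⟩ : ∃ k : ℂ, VertexValue α (fun j => r j + k • ψ j) (fun j => r' j + k • ψ' j) := by
    induction α using OnePoint.rec with
    | infty =>
      exact ⟨0, fun a ha => absurd ha (OnePoint.infty_ne_coe a), fun _ j => by simp [hr0]⟩
    | coe a =>
      have hne : (a : ℂ) - ∑ j, ψ' j 0 ≠ 0 := by
        intro h
        have h1 := congrArg Complex.im h
        rw [Complex.sub_im, Complex.ofReal_im, Complex.im_sum, Complex.zero_im, zero_sub,
          neg_eq_zero] at h1
        have h2 : 0 < ∑ j, (ψ' j 0).im / z.im :=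
          Finset.sum_pos (fun j _ => hψm j) ⟨⟨0, hN⟩, Finset.mem_univ _⟩
        rw [← Finset.sum_div, h1, zero_div] at h2
        exact lt_irrefl _ h2
      refine ⟨(∑ j, r' j 0) / ((a : ℂ) - ∑ j, ψ' j 0), fun b hb => ?_,
        fun h => absurd h (OnePoint.coe_ne_infty a)⟩
      have hab : a = b := OnePoint.coe_injective hb
      subst hab
      refine ⟨(∑ j, r' j 0) / ((a : ℂ) - ∑ j, ψ' j 0), fun j => by simp [hr0, hψ0], ?_⟩
      simp only [Pi.add_apply, Pi.smul_apply, smul_eq_mul, Finset.sum_add_distrib,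
        ← Finset.mul_sum]
      field_simp
      ring
  have hu2 : ∀ j, MemLp (r j + k • ψ j) 2 (volume.restrict (link (ℓ j))) := fun j =>
    (hr2 j).add ((hψ2 j).const_smul k)
  have hs : ∀ j, IsSolAt ((link (ℓ j)).indicator (V j)) z (g j) (r j + k • ψ j)
      (r' j + k • ψ' j) := fun j => IsSolAt.add_smul (hQ j) (hg j) (hr j) (hψ j) k
  let x : StateSpace ℓ := WithLp.toLp 2 fun j => (hu2 j).toLp _
  have hx : ∀ j, (x j : ℝ → ℂ) =ᵐ[volume.restrict (link (ℓ j))] r j + k • ψ j := fun j =>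
    (hu2 j).coeFn_toLp
  refine ⟨(x, z • x + f), mem_hamiltonianGraph_of_isSol hV
    (fun j => locallyIntegrable_rhs z (hg j) (hs j).continuous) hx (fun j => ?_) hs hk
    (fun j => (hre j).add_smul (hψe j) k), rfl⟩
  have e1 : (((z • x + f : StateSpace ℓ) j : Lp ℂ 2 (volume.restrict (link (ℓ j)))) : ℝ → ℂ)
      =ᵐ[volume.restrict (link (ℓ j))] (z • x j : Lp ℂ 2 (volume.restrict (link (ℓ j)))) + f j :=
    Lp.coeFn_add _ _
  filter_upwards [e1, Lp.coeFn_smul z (x j), hx j, hge j] with t h1 h2 h3 h4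
  rw [h1, Pi.add_apply, h2, Pi.smul_apply, h3, h4, smul_eq_mul]

end Star

end StarGraph

end

/-- Self-adjointness of the Schrödinger operator `H_α(V)` on a star graph. -/
theorem mainTheorem5 (N : ℕ) (hN : 2 ≤ N)
    (ℓ : Fin N → EReal) (hℓ : ∀ j, 0 < ℓ j)
    (V : Fin N → ℝ → ℝ)
    (hV : ∀ j, LocallyIntegrableOn (V j) (StarGraph.closedLink (ℓ j)))
    (hLP : ∀ j, ℓ j = ⊤ → StarGraph.IsLimitPointAtInfinity (V j))
    (ω : Fin N → ℝ) (α : OnePoint ℝ) :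
    IsSelfAdjoint (StarGraph.hamiltonian ℓ V ω α) := by
  refine StarGraph.isSelfAdjoint_of_surjective ?_ ?_
  · rw [StarGraph.hamiltonian_graph]
    exact fun p hp q hq => StarGraph.hamiltonianGraph_symmetric hℓ hV hLP hp hq
  · rw [StarGraph.hamiltonian_graph]
    exact fun z hz f => StarGraph.hamiltonianGraph_surjective (by omega) hℓ hV hz f
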